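/- **Armature Lemma.** All posets are nonempty sets, and ideals of a poset are nonempty directed lower subsets. *Posets.* For a subset $Y$ of a poset $X$, let $\triangledown Y$ be the set of minimal elements of the set of all upper bounds of $Y$; write $u\triangledown v:=\triangledown\{u,v\}$. A subset $Z$ of $X$ is $\triangledown$-closed if $\triangledown Y\subseteq Z$ for every finite $Y\subseteq Z$. A *pseudo join-semilattice* is a poset in which the set of upper bounds of $Y$ is a finitely generated upper subset whenever $Y$ is empty or has exactly two elements; it is *supported* if moreover the $\triangledown$-closure of every finite subset is finite. A *norm-covering* of a poset $P$ is a pseudo join-semilattice $X$ with an isotone map $\partial\colon X\to P$. An ideal $\boldsymbol x$ of $X$ is *sharp* if $\{\partial u: u\in\boldsymbol x\}$ has a largest element, then denoted $\partial\boldsymbol x$; sharp ideals are ordered by containment. *Lifters.* Let $\lambda$ be an infinite cardinal and let $[X]^{<\lambda}$ be the set of subsets of $X$ with fewer than $\lambda$ elements. A *$\lambda$-lifter* of $P$ is a pair $(X,\boldsymbol X)$, where $X$ is a norm-covering of $P$ and $\boldsymbol X$ is a set of sharp ideals of $X$, such that, with $\boldsymbol X^{=}:=\{\boldsymbol x\in\boldsymbol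 X:\partial\boldsymbol x\text{ is not maximal in }P\}$: (i) $\operatorname{card}\{\boldsymbol y\in\boldsymbol X:\boldsymbol y\subseteq\boldsymbol x\}<\operatorname{cf}(\lambda)$ for each $\boldsymbol x\in\boldsymbol X^{=}$; (ii) for every map $V\colon\boldsymbol X^{=}\to[X]^{<\lambda}$ there is an isotone $\sigma\colon P\to\boldsymbol X$ with $\partial\sigma(p)=p$ for all $p$ and $V(\sigma(a))\cap\sigma(b)\subseteq\sigma(a)$ for all $a<b$ in $P$; (iii) if $\lambda=\aleph_0$, then $X$ is supported. *Scaled Boolean algebras.* A *$P$-scaled Boolean algebra* $\boldsymbol B$ is a Boolean algebra $B$ (with $0\ne1$) with ideals $B^{(p)}$, $p\in P$, such that, in the lattice of ideals of $B$, $B=\bigvee_{p}B^{(p)}$ and $B^{(p)}\cap B^{(q)}=\bigvee_{r\ge p,q}B^{(r)}$; morphisms are the Boolean homomorphisms $f$ with $f(A^{(p)})\subseteq B^{(p)}$ for all $p$. It is *compact* if $B$ is finite and, for every atom $a$, $\{p: a\in B^{(p)}\}$ has a largest element $|a|$. The algebra $\boldsymbol 2[p]$ is $\{0,1\}$ with $\boldsymbol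 2[p]^{(q)}=\{0,1\}$ if $q\le p$ and $\{0\}$ otherwise. For a norm-covering $X$ of $P$, $\mathbf F(X)$ is the Boolean algebra with generators $\tilde u$ ($u\in X$) and relations $\tilde v\le\tilde u$ ($u\le v$), $\tilde u\wedge\tilde v=\bigvee\{\tilde w: w\in u\triangledown v\}$, $1=\bigvee\{\tilde u: u\text{ minimal in }X\}$, scaled by letting $\mathbf F(X)^{(p)}$ be the ideal generated by $\{\tilde u: p\le\partial u\}$. For a sharp ideal $\boldsymbol x$ of $X$, $\pi^X_{\boldsymbol x}\colon\mathbf F(X)\to\boldsymbol 2[\partial\boldsymbol x]$ is the morphism with $\tilde v\mapsto 1$ if $v\in\boldsymbol x$ and $\tilde v\mapsto0$ otherwise. *Condensates.* Let $\mathcal A$ be a category with all small directed colimits and products of any two objects, and let $\vec A=(A_p,\alpha_p^q)_{p\le q\text{ in }P}$ be a $P$-indexed diagram in $\mathcal A$. For compact $\boldsymbol B$, $\boldsymbol B\otimes\vec A:=\prod_{u}A_{|u|}$ over the atoms $u$ of $B$, and for a morphism $\varphi\colon\boldsymbol B\to\boldsymbol B'$ of compact algebras, $\varphi\otimes\vec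 A$ is the morphism whose component at an atom $v$ of $B'$ is the projection at $v^\varphi$ followed by $\alpha_{|v^\varphi|}^{|v|}$, where $v^\varphi$ is the unique atom $u$ of $B$ with $v\le\varphi(u)$. This functor is extended to all $P$-scaled Boolean algebras by directed colimits: $\boldsymbol B\otimes\vec A$ is the colimit of the $\boldsymbol K\otimes\vec A$ over the compact $\boldsymbol K$ with a morphism to $\boldsymbol B$. In particular $\boldsymbol 2[p]\otimes\vec A$ is canonically identified with $A_p$. *Weakly presented objects.* An object $T$ of a category is *weakly $\lambda$-presented* if for every set $\Omega$ and every colimit $(B,b_Z)_{Z\in[\Omega]^{<\lambda}}$ of a diagram indexed by $([\Omega]^{<\lambda},\subseteq)$ that preserves all small directed colimits of its index poset, every morphism $T\to B$ factors through some $b_Z$. **Statement.** Let $\lambda$ be an infinite cardinal, let $P$ be a poset with a $\lambda$-lifter $(X,\boldsymbol X)$, let $\mathcal A$ and $\mathcal S$ be categories and let $\Phi\colon\mathcal A\to\mathcal S$ be a functor. Assume that $\mathcal A$ has all small directed colimits, that any two objects of $\mathcal A$ have a product, and that $\Phi$ preserves all small directed colimits. Let $\vec A=(A_p,\alpha_p^q)_{p\le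 q\text{ in }P}$ be a $P$-indexed diagram in $\mathcal A$, let $S$ be an object of $\mathcal S$, let $\chi\colon S\to\Phi(\mathbf F(X)\otimes\vec A)$ be a morphism, and let $((S_{\boldsymbol x},\varphi_{\boldsymbol x}),\varphi_{\boldsymbol x}^{\boldsymbol y})_{\boldsymbol x\subseteq\boldsymbol y\text{ in }\boldsymbol X}$ be an $\boldsymbol X$-indexed diagram in the category $\mathcal S\downarrow S$ of objects over $S$ such that $S_{\boldsymbol x}$ is weakly $\lambda$-presented for each $\boldsymbol x\in\boldsymbol X^{=}$. Put $\rho_{\boldsymbol x}:=\Phi(\pi^X_{\boldsymbol x}\otimes\vec A)\circ\chi\colon S\to\Phi(A_{\partial\boldsymbol x})$ for $\boldsymbol x\in\boldsymbol X$. Then there is an isotone map $\sigma\colon P\to\boldsymbol X$ with $\partial\sigma(p)=p$ for all $p\in P$ such that the family $(\rho_{\sigma(p)}\circ\varphi_{\sigma(p)})_{p\in P}$ is a natural transformation from the diagram $(S_{\sigma(p)},\varphi_{\sigma(p)}^{\sigma(q)})_{p\le q\text{ in }P}$ to $\Phi\vec A$. -/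

import Mathlib

open CategoryTheory CategoryTheory.Limits Cardinal

universe u v w v₁ u₁ v₂ u₂

namespace CLL

/-! ### Posets -/

section Posets

variable {X : Type u} [PartialOrder X]

/-- `▽ Y`: the set of all minimal elements of the set of upper bounds of `Y`. -/
def minUpper (Y : Set X) : Set X := {m | Minimal (· ∈ upperBounds Y) m}

/-- A subset `Z` is `▽`-closed if `▽ Y ⊆ Z` for every finite `Y ⊆ Z`. -/
def IsNablaClosed (Z : Set X) : Prop :=
  ∀ Y : Set X, Y.Finite → Y ⊆ Z → minUpper Y ⊆ Z

/-- The `▽`-closure of `Y`: the least `▽`-closed subset containing `Y`. -/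
def nablaClosure (Y : Set X) : Set X := ⋂₀ {Z | IsNablaClosed Z ∧ Y ⊆ Z}

variable (X) in
/-- A pseudo join-semilattice: for `Y` empty or with exactly two elements, the upper subset of all
upper bounds of `Y` is finitely generated. -/
def IsPseudoJoinSemilattice : Prop :=
  ∀ Y : Set X, (Y = ∅ ∨ Y.ncard = 2) →
    ∃ V : Set X, V.Finite ∧ upperBounds Y = {x | ∃ v ∈ V, v ≤ x}

variable (X) in
/-- A supported poset: a pseudo join-semilattice in which the `▽`-closure of every finite subset
is finite. -/
def IsSupported : Prop :=
  IsPseudoJoinSemilattice X ∧ ∀ Y : Set X, Y.Finite → (nablaClosure Y).Finite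

theorem finite_minUpper_of_gen {Y V : Set X} (hV : V.Finite)
    (h : upperBounds Y = {x | ∃ v ∈ V, v ≤ x}) :
    (minUpper Y).Finite ∧ ∀ x ∈ upperBounds Y, ∃ m ∈ minUpper Y, m ≤ x := by
  have hVY : ∀ v ∈ V, v ∈ upperBounds Y := fun v hv => by rw [h]; exact ⟨v, hv, le_rfl⟩
  refine ⟨hV.subset fun m hm => ?_, fun x hx => ?_⟩
  · have h1 : m ∈ upperBounds Y := hm.1
    rw [h] at h1
    obtain ⟨v, hv, hvm⟩ := h1
    have := hm.2 (hVY v hv) hvm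
    rwa [le_antisymm this hvm]
  · rw [h] at hx
    obtain ⟨v, hv, hvx⟩ := hx
    obtain ⟨m, hmv, hm⟩ := hV.exists_le_minimal hv
    refine ⟨m, ⟨hVY m hm.1, fun y hy hym => ?_⟩, hmv.trans hvx⟩
    have hy' : y ∈ upperBounds Y := hy
    rw [h] at hy'
    obtain ⟨w, hw, hwy⟩ := hy'
    exact (hm.2 hw (hwy.trans hym)).trans hwy

theorem IsPseudoJoinSemilattice.pair (hX : IsPseudoJoinSemilattice X) (u v : X) :
    (minUpper {u, v}).Finite ∧
      ∀ x ∈ upperBounds {u, v}, ∃ m ∈ minUpper {u, v}, m ≤ x := by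
  by_cases huv : u = v
  · subst huv
    refine finite_minUpper_of_gen (V := {u}) (Set.finite_singleton u) ?_
    ext x
    simp
  · obtain ⟨V, hV, h⟩ := hX {u, v} (Or.inr (Set.ncard_pair huv))
    exact finite_minUpper_of_gen hV h

theorem IsPseudoJoinSemilattice.empty (hX : IsPseudoJoinSemilattice X) :
    {m : X | IsMin m}.Finite ∧ ∀ x : X, ∃ m, IsMin m ∧ m ≤ x := by
  obtain ⟨V, hV, h⟩ := hX ∅ (Or.inl rfl)
  have := finite_minUpper_of_gen hV h
  have e : (minUpper (∅ : Set X)) = {m : X | IsMin m} := by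
    ext m
    simp [minUpper, Minimal, IsMin]
  rw [e] at this
  exact ⟨this.1, fun x => this.2 x (by simp)⟩

end Posets

/-! ### Scaled Boolean algebras -/

/-- A `P`-scaled Boolean algebra: a Boolean algebra with `0 ≠ 1`, together with ideals `A^(p)`,
for `p ∈ P`, such that, in the lattice of ideals, the join of all `A^(p)` is everything and
`A^(p) ∩ A^(q)` is the join of all `A^(r)` with `r ≥ p, q`. -/
structure BoolP (P : Type u) [PartialOrder P] where
  /-- the underlying Boolean algebra -/
  carrier : Type u
  [str : BooleanAlgebra carrier]
  [nontriv : Nontrivial carrier]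
  /-- the ideals `A^(p)` -/
  scale : P → Order.Ideal carrier
  iSup_scale : ⨆ p, scale p = ⊤
  scale_inf_scale : ∀ p q, scale p ⊓ scale q = ⨆ r : {r : P // p ≤ r ∧ q ≤ r}, scale r

attribute [instance] BoolP.str BoolP.nontriv

variable {P : Type u} [PartialOrder P]

/-- Morphisms of `P`-scaled Boolean algebras: homomorphisms of Boolean algebras (that is, bounded
lattice homomorphisms) with `f(A^(p)) ⊆ B^(p)` for all `p`. -/
@[ext]
structure BoolP.Hom (A B : BoolP P) where
  /-- the underlying homomorphism -/
  hom : BoundedLatticeHom A.carrier B.carrier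
  map_scale : ∀ p, ∀ x ∈ A.scale p, hom x ∈ B.scale p

instance : Category (BoolP P) where
  Hom := BoolP.Hom
  id A := ⟨BoundedLatticeHom.id _, fun _ _ hx => hx⟩
  comp f g := ⟨g.hom.comp f.hom, fun p x hx => g.map_scale p _ (f.map_scale p x hx)⟩

@[ext]
theorem BoolP.hom_ext {A B : BoolP P} {f g : A ⟶ B} (h : ∀ x, f.hom x = g.hom x) : f = g :=
  BoolP.Hom.ext (DFunLike.ext _ _ h)

theorem BoolP.comp_hom {A B C : BoolP P} (f : A ⟶ B) (g : B ⟶ C) (x : A.carrier) :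
    (f ≫ g).hom x = g.hom (f.hom x) := rfl

theorem BoolP.id_hom {A : BoolP P} (x : A.carrier) : (𝟙 A : A ⟶ A).hom x = x := rfl

/-- `A` is compact if its underlying algebra is finite and, for every atom `a`, the set
`‖a‖ = {p | a ∈ A^(p)}` has a largest element. -/
def BoolP.IsCompact : ObjectProperty (BoolP P) := fun A =>
  Finite A.carrier ∧ ∀ a : A.carrier, IsAtom a → ∃ p, IsGreatest {p | a ∈ A.scale p} p

/-! ### Generalities on ideals and finite Boolean algebras -/

theorem scale_antitone (A : BoolP P) {p q : P} (h : p ≤ q) : A.scale q ≤ A.scale p := by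
  have h2 : A.scale q ≤ A.scale p ⊓ A.scale q := by
    rw [A.scale_inf_scale p q]
    exact le_iSup (fun r : {r : P // p ≤ r ∧ q ≤ r} => A.scale r) ⟨q, h, le_rfl⟩
  exact h2.trans inf_le_left

/-- The residual of `K` by `J`. -/
def residual {B : Type u} [BooleanAlgebra B] (J K : Order.Ideal B) : Order.Ideal B :=
  Order.IsIdeal.toIdeal (I := {x | ∀ y ∈ J, x ⊓ y ∈ K})
    { IsLowerSet := fun a b hba ha y hy => K.lower (inf_le_inf_right y hba) (ha y hy)
      Nonempty := ⟨⊥, fun y _ => by simp⟩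
      Directed := fun a ha b hb => ⟨a ⊔ b, fun y hy => by
        rw [inf_sup_right]
        exact Order.Ideal.sup_mem (ha y hy) (hb y hy), le_sup_left, le_sup_right⟩ }

theorem mem_residual {B : Type u} [BooleanAlgebra B] {J K : Order.Ideal B} {x : B} :
    x ∈ residual J K ↔ ∀ y ∈ J, x ⊓ y ∈ K := Iff.rfl

theorem iSup_inf_iSup_le {B : Type u} [BooleanAlgebra B] {α β : Type u} {I : α → Order.Ideal B}
    {J : β → Order.Ideal B} {K : Order.Ideal B} (h : ∀ i j, I i ⊓ J j ≤ K) :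
    (⨆ i, I i) ⊓ (⨆ j, J j) ≤ K := by
  have h1 : ∀ i, (⨆ j, J j) ≤ residual (I i) K := fun i => iSup_le fun j x hx => by
    rw [mem_residual]
    intro y hy
    exact h i j ⟨(I i).lower inf_le_right hy, (J j).lower inf_le_left hx⟩
  have h2 : (⨆ i, I i) ≤ residual (⨆ j, J j) K := iSup_le fun i x hx => by
    rw [mem_residual]
    intro y hy
    have := mem_residual.1 (h1 i hy) x hx
    rwa [inf_comm] at this
  intro x hx
  have := mem_residual.1 (h2 hx.1) x hx.2
  rwa [inf_idem] at this

theorem atom_le_sup {B : Type u} [BooleanAlgebra B] {a x y : B} (ha : IsAtom a)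
    (h : a ≤ x ⊔ y) : a ≤ x ∨ a ≤ y := by
  by_contra! hc
  have h1 : a ⊓ x = ⊥ := (ha.le_iff.1 inf_le_left).resolve_right fun e => hc.1 (inf_eq_left.1 e)
  have h2 : a ⊓ y = ⊥ := (ha.le_iff.1 inf_le_left).resolve_right fun e => hc.2 (inf_eq_left.1 e)
  apply ha.1
  rw [← inf_eq_left.2 h, inf_sup_left, h1, h2, sup_bot_eq]

/-- For a homomorphism `φ` from a finite Boolean algebra and an atom `v` of the target, there is a
unique atom `u` of the source such that `v ≤ φ(u)`. -/
theorem existsUnique_atom {A B : Type u} [BooleanAlgebra A] [BooleanAlgebra B] [Finite A]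
    (φ : BoundedLatticeHom A B) {v : B} (hv : IsAtom v) :
    ∃! a : A, IsAtom a ∧ v ≤ φ a := by
  obtain ⟨m, -, hm⟩ := (Set.toFinite {x : A | v ≤ φ x}).exists_le_minimal
    (a := ⊤) (by simp)
  have hvm : v ≤ φ m := hm.1
  refine ⟨m, ⟨⟨fun h0 => hv.1 ?_, fun y hy => ?_⟩, hvm⟩, fun a ⟨ha, hva⟩ => ?_⟩
  · rw [h0, map_bot] at hvm
    exact le_bot_iff.1 hvm
  · have h1 : v ≤ φ y ⊔ φ (m \ y) := by
      rw [← map_sup, sup_sdiff_cancel_right hy.le]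
      exact hvm
    rcases atom_le_sup hv h1 with h | h
    · exact absurd (hm.2 h hy.le) (not_le_of_gt hy)
    · have h2 : m ≤ m \ y := hm.2 h sdiff_le
      have h3 : y ≤ m \ y := hy.le.trans h2
      exact le_bot_iff.1 ((le_inf le_rfl h3).trans (by simp))
  · have h1 : v ≤ φ (a ⊓ m) := by
      rw [map_inf]
      exact le_inf hva hvm
    rcases ha.le_iff.1 (inf_le_left : a ⊓ m ≤ a) with h | h
    · rw [h, map_bot] at h1
      exact absurd (le_bot_iff.1 h1) hv.1
    · have h2 : m ≤ a ⊓ m := hm.2 h1 inf_le_right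
      exact le_antisymm (inf_eq_left.1 h) (h2.trans inf_le_left)

/-! ### Finite `P`-normed spaces with principal norms, and the algebras `2[p]` -/

theorem set_mem_ideal {ι : Type u} [Finite ι] (K : Order.Ideal (Set ι)) (x : Set ι)
    (h : ∀ i ∈ x, {i} ∈ K) : x ∈ K := by
  induction x, x.toFinite using Set.Finite.induction_on with
  | empty => exact Order.Ideal.bot_mem K
  | @insert a s _ _ ih =>
    have h1 := Order.Ideal.sup_mem (h a (by simp)) (ih fun i hi => h i (by simp [hi]))
    simpa using h1

/-- The dual algebra of the finite `P`-normed space `ι` with norm `‖i‖ = P ↓ ℓ i`: the powerset of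
`ι`, where `x` belongs to the `p`-th ideal if and only if `p ≤ ℓ i` for all `i ∈ x`. -/
def BoolP.ofLabels {ι : Type u} [Finite ι] [Nonempty ι] (l : ι → P) : BoolP P where
  carrier := Set ι
  scale p := Order.Ideal.principal {i | p ≤ l i}
  iSup_scale := by
    rw [eq_top_iff]
    intro x _
    refine set_mem_ideal _ x fun i _ => ?_
    refine (le_iSup (fun p => Order.Ideal.principal {i | p ≤ l i}) (l i)) ?_
    exact Order.Ideal.mem_principal.2 (by simp)
  scale_inf_scale p q := by
    apply le_antisymm
    · intro x hx
      refine set_mem_ideal _ x fun i hi => ?_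
      refine (le_iSup (fun r : {r : P // p ≤ r ∧ q ≤ r} =>
        Order.Ideal.principal {i | r.1 ≤ l i}) ⟨l i, ?_, ?_⟩) ?_
      · exact Order.Ideal.mem_principal.1 hx.1 hi
      · exact Order.Ideal.mem_principal.1 hx.2 hi
      · exact Order.Ideal.mem_principal.2 (by simp)
    · refine iSup_le fun r => le_inf ?_ ?_
      · exact Order.Ideal.principal_le_iff.2
          (Order.Ideal.mem_principal.2 fun i hi => r.2.1.trans hi)
      · exact Order.Ideal.principal_le_iff.2
          (Order.Ideal.mem_principal.2 fun i hi => r.2.2.trans hi)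

theorem BoolP.mem_ofLabels_scale {ι : Type u} [Finite ι] [Nonempty ι] (l : ι → P) (p : P)
    (x : Set ι) : x ∈ (BoolP.ofLabels l).scale p ↔ ∀ i ∈ x, p ≤ l i :=
  Order.Ideal.mem_principal

theorem BoolP.ofLabels_isCompact {ι : Type u} [Finite ι] [Nonempty ι] (l : ι → P) :
    (BoolP.ofLabels l).IsCompact := by
  refine ⟨inferInstanceAs (Finite (Set ι)), fun a ha => ?_⟩
  obtain ⟨i, rfl⟩ := Set.isAtom_iff.1 (show IsAtom (α := Set ι) a from ha)
  refine ⟨l i, (BoolP.mem_ofLabels_scale l _ _).2 fun j hj => ?_, fun p hp => ?_⟩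
  · rw [Set.mem_singleton_iff.1 hj]
  · exact (BoolP.mem_ofLabels_scale l _ _).1 hp i rfl

variable (P) in
/-- The category of compact `P`-scaled Boolean algebras. -/
abbrev CompactBoolP := (BoolP.IsCompact (P := P)).FullSubcategory

/-- The algebra `2[p]`: the two-element Boolean algebra, realized as the powerset of a point, with
`2[p]^(q) = {0, 1}` if `q ≤ p` and `2[p]^(q) = {0}` otherwise. -/
def two (p : P) : BoolP P := BoolP.ofLabels (ι := PUnit.{u + 1}) fun _ => p

theorem two_isCompact (p : P) : (two p).IsCompact := BoolP.ofLabels_isCompact _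

/-- `2[p]` as a compact algebra. -/
def compactTwo (p : P) : CompactBoolP P := ⟨two p, two_isCompact p⟩

theorem mem_two_scale (p q : P) (x : Set PUnit.{u + 1}) :
    x ∈ (two p).scale q ↔ ∀ i ∈ x, q ≤ p := BoolP.mem_ofLabels_scale _ _ _

/-! ### Tensoring compact algebras with a diagram -/

/-- The set `At A` of all atoms of (the underlying algebra of) `A`. -/
abbrev At (A : CompactBoolP P) : Type u := {a : A.obj.carrier // IsAtom a}

/-- `|a|`: the largest element of `‖a‖`, for an atom `a` of a compact algebra. -/
noncomputable def atomNorm {A : CompactBoolP P} (a : At A) : P := (A.property.2 a.1 a.2).choose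

theorem atomNorm_spec {A : CompactBoolP P} (a : At A) :
    IsGreatest {p | a.1 ∈ A.obj.scale p} (atomNorm a) := (A.property.2 a.1 a.2).choose_spec

instance (A : CompactBoolP P) : Finite A.obj.carrier := A.property.1

instance (A : CompactBoolP P) : Finite (At A) := Subtype.finite

instance (A : CompactBoolP P) : Nonempty (At A) := by
  obtain ⟨a, ha, -⟩ := (Finite.to_isAtomic (α := A.obj.carrier)).eq_bot_or_exists_atom_le ⊤
    |>.resolve_left top_ne_bot
  exact ⟨⟨a, ha⟩⟩

/-- `v^φ`: the unique atom `u` of `A` such that `v ≤ φ(u)`, for an atom `v` of `B`. -/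
noncomputable def pullAtom {A B : CompactBoolP P} (φ : A ⟶ B) (v : At B) : At A :=
  ⟨(existsUnique_atom φ.hom.hom v.2).choose, (existsUnique_atom φ.hom.hom v.2).choose_spec.1.1⟩

theorem le_pullAtom {A B : CompactBoolP P} (φ : A ⟶ B) (v : At B) :
    v.1 ≤ φ.hom.hom (pullAtom φ v).1 := (existsUnique_atom φ.hom.hom v.2).choose_spec.1.2

theorem eq_pullAtom {A B : CompactBoolP P} (φ : A ⟶ B) (v : At B) (u : At A)
    (h : v.1 ≤ φ.hom.hom u.1) : u = pullAtom φ v :=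
  Subtype.ext ((existsUnique_atom φ.hom.hom v.2).choose_spec.2 u.1 ⟨u.2, h⟩)

theorem atomNorm_pullAtom_le {A B : CompactBoolP P} (φ : A ⟶ B) (v : At B) :
    atomNorm (pullAtom φ v) ≤ atomNorm v :=
  (atomNorm_spec v).2 ((B.obj.scale _).lower (le_pullAtom φ v)
    (φ.hom.map_scale _ _ (atomNorm_spec (pullAtom φ v)).1))

section Tensor

variable {C : Type w} [Category.{v} C]

theorem hasProduct_fin_succ [HasBinaryProducts C] (n : ℕ) (f : Fin (n + 1) → C) :
    HasProduct f := by
  induction n with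
  | zero =>
    have : Subsingleton (Fin (0 + 1)) := inferInstanceAs (Subsingleton (Fin 1))
    exact hasProduct_unique f
  | succ n ih =>
    have := ih fun i : Fin (n + 1) => f i.succ
    exact ⟨⟨_, extendFanIsLimit f (limit.isLimit (Discrete.functor fun i : Fin (n + 1) => f i.succ))
      (limit.isLimit (pair (f 0) _))⟩⟩

theorem hasProduct_of_finite [HasBinaryProducts C] {ι : Type u} [Finite ι] [Nonempty ι]
    (f : ι → C) : HasProduct f := by
  obtain ⟨n, ⟨e⟩⟩ := Finite.exists_equiv_fin ι
  cases n with
  | zero => exact (e (Classical.arbitrary ι)).elim0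
  | succ n =>
    have := hasProduct_fin_succ n fun i => f (e.symm i)
    exact hasProduct_of_equiv_of_iso (fun i => f (e.symm i)) f e
      fun j => eqToIso (by simp)

theorem π_map_eq {S : P ⥤ C} {A : CompactBoolP P} [HasProduct fun u : At A => S.obj (atomNorm u)]
    {u u' : At A} (h : u = u') {q : P} (hu : atomNorm u ≤ q) (hu' : atomNorm u' ≤ q) :
    Pi.π (fun u : At A => S.obj (atomNorm u)) u ≫ S.map (homOfLE hu) =
      Pi.π (fun u : At A => S.obj (atomNorm u)) u' ≫ S.map (homOfLE hu') := by
  subst h; rfl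

variable [HasBinaryProducts C]

instance (S : P ⥤ C) (A : CompactBoolP P) : HasProduct fun u : At A => S.obj (atomNorm u) :=
  hasProduct_of_finite _

/-- The functor `_ ⊗ S` on compact `P`-scaled Boolean algebras, for a `P`-indexed diagram `S`:
`A ⊗ S` is the product of all `S_|u|`, for `u` an atom of `A`, and `φ ⊗ S` is the morphism whose
component at an atom `v` of `B` is the projection at `v^φ` followed by the transition morphism
from `S_|v^φ|` to `S_|v|`. -/
noncomputable def compactTensor (S : P ⥤ C) : CompactBoolP P ⥤ C where
  obj A := ∏ᶜ fun u : At A => S.obj (atomNorm u)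
  map {A B} φ := Pi.lift fun v : At B =>
    Pi.π (fun u : At A => S.obj (atomNorm u)) (pullAtom φ v) ≫
      S.map (homOfLE (atomNorm_pullAtom_le φ v))
  map_id A := by
    refine Pi.hom_ext _ _ fun v => ?_
    have h : v = pullAtom (𝟙 A) v := eq_pullAtom (𝟙 A) v v le_rfl
    rw [Pi.lift_π, Category.id_comp, π_map_eq h.symm _ le_rfl]
    have h1 : S.map (homOfLE (le_refl (atomNorm v))) = 𝟙 _ := S.map_id _
    exact (congrArg _ h1).trans (Category.comp_id _)
  map_comp {A B D} φ ψ := by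
    refine Pi.hom_ext _ _ fun v => ?_
    have h : pullAtom φ (pullAtom ψ v) = pullAtom (φ ≫ ψ) v :=
      eq_pullAtom (φ ≫ ψ) v _ ((le_pullAtom ψ v).trans
        (OrderHomClass.mono ψ.hom.hom (le_pullAtom φ (pullAtom ψ v))))
    rw [Pi.lift_π, Category.assoc, Pi.lift_π, Pi.lift_π_assoc, Category.assoc, ← S.map_comp,
      homOfLE_comp, ← π_map_eq h]

end Tensor

/-! ### Every scaled Boolean algebra is a directed colimit of compact ones -/

/-- `W` is a finite set of pairwise disjoint nonzero elements with join `x`, each one labelled by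
an element `p` of `R` and belonging to `B^(p)`. -/
structure IsPart (B : BoolP P) (W : Finset (B.carrier × P)) (x : B.carrier) (R : Set P) :
    Prop where
  ne_bot : ∀ i ∈ W, i.1 ≠ ⊥
  mem_scale : ∀ i ∈ W, i.1 ∈ B.scale i.2
  mem_label : ∀ i ∈ W, i.2 ∈ R
  disj : ∀ i ∈ W, ∀ j ∈ W, i ≠ j → Disjoint i.1 j.1
  sup_eq : W.sup Prod.fst = x

theorem IsPart.le {B : BoolP P} {W : Finset (B.carrier × P)} {x : B.carrier} {R : Set P}
    (h : IsPart B W x R) {i : B.carrier × P} (hi : i ∈ W) : i.1 ≤ x := by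
  rw [← h.sup_eq]
  exact Finset.le_sup (f := Prod.fst) hi

theorem exists_part_mono {B : BoolP P} {R : Set P} {x y : B.carrier} (hyx : y ≤ x)
    (hx : ∃ W, IsPart B W x R) : ∃ W, IsPart B W y R := by
  classical
  obtain ⟨W, hW⟩ := hx
  refine ⟨(W.image fun i => (i.1 ⊓ y, i.2)).filter fun i => i.1 ≠ ⊥, ?_, ?_, ?_, ?_, ?_⟩
  · intro i hi
    exact (Finset.mem_filter.1 hi).2
  · intro i hi
    obtain ⟨j, hj, rfl⟩ := Finset.mem_image.1 (Finset.mem_filter.1 hi).1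
    exact (B.scale j.2).lower inf_le_left (hW.mem_scale j hj)
  · intro i hi
    obtain ⟨j, hj, rfl⟩ := Finset.mem_image.1 (Finset.mem_filter.1 hi).1
    exact hW.mem_label j hj
  · intro i hi k hk hik
    obtain ⟨j, hj, rfl⟩ := Finset.mem_image.1 (Finset.mem_filter.1 hi).1
    obtain ⟨l, hl, rfl⟩ := Finset.mem_image.1 (Finset.mem_filter.1 hk).1
    have : j ≠ l := fun e => hik (by rw [e])
    exact (hW.disj j hj l hl this).mono inf_le_left inf_le_left
  · have h1 : (W.image fun i => (i.1 ⊓ y, i.2)).sup Prod.fst = y := by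
      rw [Finset.sup_image]
      have : (Prod.fst ∘ fun i : B.carrier × P => (i.1 ⊓ y, i.2)) = fun i => i.1 ⊓ y := rfl
      rw [this, ← Finset.sup_inf_distrib_right, hW.sup_eq]
      exact inf_eq_right.2 hyx
    refine le_antisymm ((Finset.sup_mono (Finset.filter_subset _ _)).trans h1.le) ?_
    conv_lhs => rw [← h1]
    refine Finset.sup_le fun i hi => ?_
    by_cases h : i.1 = ⊥
    · rw [h]; exact bot_le
    · exact Finset.le_sup (f := Prod.fst) (Finset.mem_filter.2 ⟨hi, h⟩)

theorem exists_part_sup {B : BoolP P} {R : Set P} {x y : B.carrier}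
    (hx : ∃ W, IsPart B W x R) (hy : ∃ W, IsPart B W y R) : ∃ W, IsPart B W (x ⊔ y) R := by
  classical
  obtain ⟨V, hV⟩ := hx
  obtain ⟨W, hW⟩ := exists_part_mono (y := y \ x) sdiff_le hy
  have hd : ∀ i ∈ V, ∀ j ∈ W, Disjoint i.1 j.1 := fun i hi j hj =>
    disjoint_sdiff_self_right.mono (hV.le hi) (hW.le hj)
  refine ⟨V ∪ W, ?_, ?_, ?_, ?_, ?_⟩
  · intro i hi
    exact (Finset.mem_union.1 hi).elim (hV.ne_bot i) (hW.ne_bot i)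
  · intro i hi
    exact (Finset.mem_union.1 hi).elim (hV.mem_scale i) (hW.mem_scale i)
  · intro i hi
    exact (Finset.mem_union.1 hi).elim (hV.mem_label i) (hW.mem_label i)
  · intro i hi j hj hij
    rcases Finset.mem_union.1 hi with hi | hi <;> rcases Finset.mem_union.1 hj with hj | hj
    · exact hV.disj i hi j hj hij
    · exact hd i hi j hj
    · exact (hd j hj i hi).symm
    · exact hW.disj i hi j hj hij
  · rw [Finset.sup_union, hV.sup_eq, hW.sup_eq, sup_sdiff_self_right]

/-- The ideal of all elements that have a partition with labels in `R`. -/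
def partIdeal (B : BoolP P) (R : Set P) : Order.Ideal B.carrier :=
  Order.IsIdeal.toIdeal (I := {x | ∃ W, IsPart B W x R})
    { IsLowerSet := fun _ _ hba ha => exists_part_mono hba ha
      Nonempty := ⟨⊥, ∅, by constructor <;> simp⟩
      Directed := fun a ha b hb => ⟨a ⊔ b, exists_part_sup ha hb, le_sup_left, le_sup_right⟩ }

theorem scale_le_partIdeal (B : BoolP P) {R : Set P} {r : P} (hr : r ∈ R) :
    B.scale r ≤ partIdeal B R := by
  intro x hx
  by_cases h : x = ⊥
  · rw [h]; exact Order.Ideal.bot_mem _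
  · exact ⟨{(x, r)}, by
      constructor
      · simpa using h
      · simpa using hx
      · simpa using hr
      · simp
      · simp⟩

/-- The set of all finite labelled partitions of the unit of `B`. -/
structure BoolP.Part (B : BoolP P) where
  /-- the labelled pieces -/
  pieces : Finset (B.carrier × P)
  isPart : IsPart B pieces ⊤ Set.univ

namespace BoolP.Part

variable {B : BoolP P}

theorem eq_of_le (s : B.Part) {i j : B.carrier × P} (hi : i ∈ s.pieces) (hj : j ∈ s.pieces)
    {x : B.carrier} (hx : x ≠ ⊥) (h1 : x ≤ i.1) (h2 : x ≤ j.1) : i = j := by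
  by_contra h
  exact hx (le_bot_iff.1 (s.isPart.disj i hi j hj h h1 h2))

instance : PartialOrder B.Part where
  le s t := ∀ j ∈ t.pieces, ∃ i ∈ s.pieces, j.1 ≤ i.1 ∧ i.2 ≤ j.2
  le_refl s j hj := ⟨j, hj, le_rfl, le_rfl⟩
  le_trans s t r hst htr j hj := by
    obtain ⟨i, hi, h1, h2⟩ := htr j hj
    obtain ⟨k, hk, h3, h4⟩ := hst i hi
    exact ⟨k, hk, h1.trans h3, h4.trans h2⟩
  le_antisymm := by
    have key : ∀ s t : B.Part, (∀ j ∈ t.pieces, ∃ i ∈ s.pieces, j.1 ≤ i.1 ∧ i.2 ≤ j.2) →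
        (∀ j ∈ s.pieces, ∃ i ∈ t.pieces, j.1 ≤ i.1 ∧ i.2 ≤ j.2) → t.pieces ⊆ s.pieces := by
      intro s t hst hts j hj
      obtain ⟨i, hi, h1, h2⟩ := hst j hj
      obtain ⟨k, hk, h3, h4⟩ := hts i hi
      have : j = k := t.eq_of_le hj hk (t.isPart.ne_bot j hj) le_rfl (h1.trans h3)
      subst this
      have : j = i := Prod.ext (le_antisymm h1 h3) (le_antisymm h4 h2)
      exact this ▸ hi
    intro s t hst hts
    have : s.pieces = t.pieces := subset_antisymm (key t s hts hst) (key s t hst hts)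
    cases s; cases t; cases this; rfl

instance : Nonempty B.Part := by
  have h : (⊤ : B.carrier) ∈ partIdeal B Set.univ := by
    have h1 : (⨆ p, B.scale p) ≤ partIdeal B Set.univ :=
      iSup_le fun p => scale_le_partIdeal B (Set.mem_univ p)
    apply h1
    rw [B.iSup_scale]
    trivial
  obtain ⟨W, hW⟩ := h
  exact ⟨⟨W, hW⟩⟩

instance : IsDirectedOrder B.Part := by
  classical
  refine ⟨fun s t => ?_⟩
  have h : ∀ k : (B.carrier × P) × (B.carrier × P), k ∈ s.pieces ×ˢ t.pieces →
      ∃ W, IsPart B W (k.1.1 ⊓ k.2.1) {r | k.1.2 ≤ r ∧ k.2.2 ≤ r} := by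
    intro k hk
    rw [Finset.mem_product] at hk
    have h1 : B.scale k.1.2 ⊓ B.scale k.2.2 ≤ partIdeal B {r | k.1.2 ≤ r ∧ k.2.2 ≤ r} := by
      rw [B.scale_inf_scale]
      exact iSup_le fun r => scale_le_partIdeal B r.2
    exact h1 ⟨(B.scale _).lower inf_le_left (s.isPart.mem_scale _ hk.1),
      (B.scale _).lower inf_le_right (t.isPart.mem_scale _ hk.2)⟩
  choose! W hW using h
  refine ⟨⟨(s.pieces ×ˢ t.pieces).biUnion W, ?_, ?_, ?_, ?_, ?_⟩, ?_, ?_⟩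
  · intro i hi
    obtain ⟨k, hk, hi⟩ := Finset.mem_biUnion.1 hi
    exact (hW k hk).ne_bot i hi
  · intro i hi
    obtain ⟨k, hk, hi⟩ := Finset.mem_biUnion.1 hi
    exact (hW k hk).mem_scale i hi
  · intro i hi
    trivial
  · intro i hi j hj hij
    obtain ⟨k, hk, hi⟩ := Finset.mem_biUnion.1 hi
    obtain ⟨l, hl, hj⟩ := Finset.mem_biUnion.1 hj
    by_cases hkl : k = l
    · subst hkl
      exact (hW k hk).disj i hi j hj hij
    · have h1 := (hW k hk).le hi
      have h2 := (hW l hl).le hj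
      rw [Finset.mem_product] at hk hl
      by_cases h3 : k.1 = l.1
      · have h4 : k.2 ≠ l.2 := fun h4 => hkl (Prod.ext h3 h4)
        exact (t.isPart.disj _ hk.2 _ hl.2 h4).mono (h1.trans inf_le_right) (h2.trans inf_le_right)
      · exact (s.isPart.disj _ hk.1 _ hl.1 h3).mono (h1.trans inf_le_left) (h2.trans inf_le_left)
  · rw [Finset.sup_biUnion, Finset.sup_congr rfl fun k hk => (hW k hk).sup_eq,
      ← Finset.sup_inf_sup, s.isPart.sup_eq, t.isPart.sup_eq, inf_idem]
  · intro j hj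
    obtain ⟨k, hk, hj⟩ := Finset.mem_biUnion.1 hj
    exact ⟨k.1, (Finset.mem_product.1 hk).1, ((hW k hk).le hj).trans inf_le_left,
      ((hW k hk).mem_label j hj).1⟩
  · intro j hj
    obtain ⟨k, hk, hj⟩ := Finset.mem_biUnion.1 hj
    exact ⟨k.2, (Finset.mem_product.1 hk).2, ((hW k hk).le hj).trans inf_le_right,
      ((hW k hk).mem_label j hj).2⟩

instance (s : B.Part) : Nonempty s.pieces := by
  by_contra h
  rw [nonempty_subtype, not_exists] at h
  have h1 := s.isPart.sup_eq
  rw [Finset.eq_empty_of_forall_notMem h, Finset.sup_empty] at h1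
  exact bot_ne_top h1

/-- The compact algebra attached to a labelled partition. -/
def compact (s : B.Part) : CompactBoolP P :=
  ⟨BoolP.ofLabels fun i : s.pieces => i.1.2, BoolP.ofLabels_isCompact _⟩

/-- The underlying map of the canonical embedding. -/
noncomputable def toFun (s : B.Part) (x : Set s.pieces) : B.carrier :=
  letI := Classical.decPred (· ∈ x)
  (Finset.univ.filter (· ∈ x)).sup fun i => i.1.1

theorem toFun_le_iff (s : B.Part) (x : Set s.pieces) (b : B.carrier) :
    s.toFun x ≤ b ↔ ∀ i ∈ x, i.1.1 ≤ b := by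
  simp [toFun]

theorem le_toFun (s : B.Part) {x : Set s.pieces} {i : s.pieces} (hi : i ∈ x) :
    i.1.1 ≤ s.toFun x := (s.toFun_le_iff x _).1 le_rfl i hi

theorem le_toFun_iff (s : B.Part) {x : Set s.pieces} {i : s.pieces} :
    i.1.1 ≤ s.toFun x ↔ i ∈ x := by
  refine ⟨fun h => ?_, s.le_toFun⟩
  by_contra hi
  have h1 : Disjoint (s.toFun x) i.1.1 := by
    rw [← le_compl_iff_disjoint_right, toFun_le_iff]
    intro j hj
    rw [le_compl_iff_disjoint_right]
    exact s.isPart.disj j.1 j.2 i.1 i.2 fun e => hi (Subtype.ext e ▸ hj)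
  exact s.isPart.ne_bot i.1 i.2 (le_bot_iff.1 (h1 h le_rfl))

theorem toFun_univ (s : B.Part) : s.toFun Set.univ = ⊤ := by
  rw [eq_top_iff, ← s.isPart.sup_eq]
  exact Finset.sup_le fun i hi => s.le_toFun (i := ⟨i, hi⟩) trivial

theorem toFun_union (s : B.Part) (x y : Set s.pieces) :
    s.toFun (x ∪ y) = s.toFun x ⊔ s.toFun y := by
  refine eq_of_forall_ge_iff fun b => ?_
  simp only [toFun_le_iff, sup_le_iff, Set.mem_union]
  exact ⟨fun h => ⟨fun i hi => h i (Or.inl hi), fun i hi => h i (Or.inr hi)⟩,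
    fun h i hi => hi.elim (h.1 i) (h.2 i)⟩

theorem toFun_inter (s : B.Part) (x y : Set s.pieces) :
    s.toFun (x ∩ y) = s.toFun x ⊓ s.toFun y := by
  apply le_antisymm
  · exact le_inf ((s.toFun_le_iff _ _).2 fun i hi => s.le_toFun hi.1)
      ((s.toFun_le_iff _ _).2 fun i hi => s.le_toFun hi.2)
  · rw [← le_himp_iff, toFun_le_iff]
    intro i hi
    rw [le_himp_iff, inf_comm, ← le_himp_iff, toFun_le_iff]
    intro j hj
    rw [le_himp_iff]
    by_cases hij : j = i
    · subst hij
      exact inf_le_left.trans (s.le_toFun ⟨hi, hj⟩)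
    · have h1 := s.isPart.disj j.1 j.2 i.1 i.2 fun e => hij (Subtype.ext e)
      rw [h1.eq_bot]
      exact bot_le

/-- The canonical embedding. -/
noncomputable def toB (s : B.Part) : s.compact.obj ⟶ B where
  hom :=
    { toFun := s.toFun
      map_sup' := s.toFun_union
      map_inf' := s.toFun_inter
      map_top' := s.toFun_univ
      map_bot' := le_bot_iff.1 ((s.toFun_le_iff _ _).2 fun _ hi => hi.elim) }
  map_scale p x hx := by
    have hx' := (BoolP.mem_ofLabels_scale _ _ _).1 hx
    change (s.toFun x : B.carrier) ∈ B.scale p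
    unfold toFun
    refine (Order.Ideal.finsetSup_mem_iff _).2 fun i hi => ?_
    exact scale_antitone B (hx' i (by simpa using hi)) (s.isPart.mem_scale i.1 i.2)

theorem toB_apply (s : B.Part) (x : Set s.pieces) : s.toB.hom x = s.toFun x := rfl

theorem toFun_injective (s : B.Part) : Function.Injective s.toFun := fun x y h =>
  Set.ext fun i => by rw [← s.le_toFun_iff, ← s.le_toFun_iff, h]

instance (s : B.Part) : Mono s.toB where
  right_cancellation _ _ e := BoolP.hom_ext fun x => s.toFun_injective
    (congrArg (fun f => BoolP.Hom.hom f x) e)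

theorem toFun_preimage {s t : B.Part} (par : t.pieces → s.pieces)
    (h1 : ∀ j, j.1.1 ≤ (par j).1.1) (x : Set s.pieces) : t.toFun (par ⁻¹' x) = s.toFun x := by
  apply le_antisymm
  · exact (t.toFun_le_iff _ _).2 fun j hj => (h1 j).trans (s.le_toFun hj)
  · have h3 : s.toFun x = s.toFun x ⊓ t.toFun Set.univ := by rw [t.toFun_univ, inf_top_eq]
    rw [h3, inf_comm, ← le_himp_iff, toFun_le_iff]
    intro j _
    rw [le_himp_iff, inf_comm, ← le_himp_iff, toFun_le_iff]
    intro i hi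
    rw [le_himp_iff]
    by_cases hij : par j = i
    · exact inf_le_right.trans (t.le_toFun (show par j ∈ x from hij ▸ hi))
    · have h4 := s.isPart.disj (par j).1 (par j).2 i.1 i.2 fun e => hij (Subtype.ext e)
      rw [(h4.mono_left (h1 j)).symm.eq_bot]
      exact bot_le

theorem exists_map {s t : B.Part} (h : s ≤ t) :
    ∃ f : s.compact ⟶ t.compact, f.hom ≫ t.toB = s.toB := by
  choose g hg h1 h2 using h
  let par : t.pieces → s.pieces := fun j => ⟨g j.1 j.2, hg j.1 j.2⟩
  let f : BoundedLatticeHom (Set s.pieces) (Set t.pieces) :=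
    { toFun := fun x => par ⁻¹' x
      map_sup' := fun _ _ => rfl
      map_inf' := fun _ _ => rfl
      map_top' := rfl
      map_bot' := rfl }
  refine ⟨ObjectProperty.homMk (⟨f, fun p x hx => ?_⟩ : BoolP.Hom _ _), ?_⟩
  · refine (BoolP.mem_ofLabels_scale _ _ _).2 fun j hj => ?_
    exact ((BoolP.mem_ofLabels_scale _ _ _).1 hx _ hj).trans (h2 j.1 j.2)
  · ext x
    exact toFun_preimage par (fun j => h1 j.1 j.2) x

variable (B) in
/-- The directed diagram of compact algebras over `B` indexed by labelled partitions. -/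
noncomputable def diagram : B.Part ⥤ CostructuredArrow (BoolP.IsCompact (P := P)).ι B where
  obj s := CostructuredArrow.mk (Y := s.compact) s.toB
  map {s t} h := CostructuredArrow.homMk (exists_map (leOfHom h)).choose
    (exists_map (leOfHom h)).choose_spec
  map_id s := by
    ext : 2
    rw [← cancel_mono s.toB]
    exact (exists_map (le_refl s)).choose_spec.trans (Category.id_comp _).symm
  map_comp {s t r} h k := by
    ext : 2
    rw [← cancel_mono r.toB]
    refine (exists_map (leOfHom (h ≫ k))).choose_spec.trans ?_
    refine Eq.trans ?_ (Category.assoc _ _ _).symm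
    refine Eq.trans ?_ (congrArg _ (exists_map (leOfHom k)).choose_spec.symm)
    exact (exists_map (leOfHom h)).choose_spec.symm

theorem exists_factor {K : CompactBoolP P} (f : K.obj ⟶ B) :
    ∃ (s : B.Part) (g : K ⟶ s.compact), g.hom ≫ s.toB = f := by
  classical
  have := Fintype.ofFinite (At K)
  have hsup : ∀ k : K.obj.carrier, ∀ b : B.carrier,
      (∀ a : At K, a.1 ≤ k → f.hom a.1 ≤ b) → f.hom k ≤ b := by
    intro k b h
    let y : K.obj.carrier := (Finset.univ.filter fun a : At K => a.1 ≤ k).sup fun a => a.1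
    have hky : k ≤ y := by
      by_contra hc
      have h0 : k \ y ≠ ⊥ := fun e => hc (sdiff_eq_bot_iff.1 e)
      obtain ⟨a, ha, hak⟩ := (Finite.to_isAtomic (α := K.obj.carrier)).eq_bot_or_exists_atom_le
        (k \ y) |>.resolve_left h0
      have h1 : a ≤ y := Finset.le_sup (f := fun a : At K => a.1) (b := ⟨a, ha⟩)
        (by simpa using hak.trans sdiff_le)
      exact ha.1 (le_bot_iff.1 (disjoint_sdiff_self_right h1 hak))
    refine (OrderHomClass.mono f.hom hky).trans ?_
    rw [map_finset_sup]
    exact Finset.sup_le fun a ha => h a (by simpa using ha)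
  have hdisj : ∀ a a' : At K, a ≠ a' → Disjoint (f.hom a.1) (f.hom a'.1) := by
    intro a a' h
    have h1 : a.1 ⊓ a'.1 = ⊥ := by
      refine (a.2.le_iff.1 inf_le_left).resolve_right fun e => h (Subtype.ext ?_)
      exact (a'.2.le_iff.1 (inf_eq_left.1 e)).resolve_left a.2.1
    rw [disjoint_iff, ← map_inf, h1, map_bot]
  let W : Finset (B.carrier × P) :=
    (Finset.univ.filter fun a : At K => f.hom a.1 ≠ ⊥).image fun a => (f.hom a.1, atomNorm a)
  have hW : ∀ i, i ∈ W ↔ ∃ a : At K, f.hom a.1 ≠ ⊥ ∧ (f.hom a.1, atomNorm a) = i := by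
    intro i
    simp [W]
  obtain ⟨s, hW⟩ : ∃ s : B.Part, ∀ i, i ∈ s.pieces ↔
      ∃ a : At K, f.hom a.1 ≠ ⊥ ∧ (f.hom a.1, atomNorm a) = i := ⟨
    { pieces := W
      isPart :=
        { ne_bot := by
            intro i hi
            obtain ⟨a, ha, rfl⟩ := (hW i).1 hi
            exact ha
          mem_scale := by
            intro i hi
            obtain ⟨a, ha, rfl⟩ := (hW i).1 hi
            exact f.map_scale _ _ (atomNorm_spec a).1
          mem_label := fun _ _ => trivial
          disj := by
            intro i hi j hj hij
            obtain ⟨a, ha, rfl⟩ := (hW i).1 hi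
            obtain ⟨a', ha', rfl⟩ := (hW j).1 hj
            exact hdisj a a' fun e => hij (by rw [e])
          sup_eq := by
            rw [eq_top_iff, ← map_top f.hom]
            refine hsup _ _ fun a _ => ?_
            by_cases h : f.hom a.1 = ⊥
            · rw [h]; exact bot_le
            · exact Finset.le_sup (f := Prod.fst) ((hW _).2 ⟨a, h, rfl⟩) } }, hW⟩
  have hat : ∀ i : s.pieces, ∃ a : At K, f.hom a.1 ≠ ⊥ ∧ (f.hom a.1, atomNorm a) = i.1 :=
    fun i => (hW i.1).1 i.2
  choose at' h1 h2 using hat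
  let g : BoundedLatticeHom K.obj.carrier (Set s.pieces) :=
    { toFun := fun k => {i | (at' i).1 ≤ k}
      map_sup' := fun x y => Set.ext fun i =>
        ⟨fun h => atom_le_sup (at' i).2 h, fun h => h.elim (le_sup_of_le_left ·)
          (le_sup_of_le_right ·)⟩
      map_inf' := fun x y => Set.ext fun i => le_inf_iff
      map_top' := Set.ext fun i => ⟨fun _ => trivial, fun _ => le_top⟩
      map_bot' := Set.ext fun i => ⟨fun h => (at' i).2.1 (le_bot_iff.1 h), fun h => h.elim⟩ }
  refine ⟨s, ObjectProperty.homMk (⟨g, fun p x hx => ?_⟩ : BoolP.Hom _ _), ?_⟩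
  · refine (BoolP.mem_ofLabels_scale _ _ _).2 fun i hi => ?_
    have h3 := (atomNorm_spec (at' i)).2 ((K.obj.scale p).lower hi hx)
    exact h3.trans (congrArg Prod.snd (h2 i)).le
  · ext x
    change s.toFun {i | (at' i).1 ≤ x} = f.hom x
    apply le_antisymm
    · refine (s.toFun_le_iff _ _).2 fun i hi => ?_
      rw [← h2 i]
      exact OrderHomClass.mono f.hom hi
    · refine hsup _ _ fun a ha => ?_
      by_cases h : f.hom a.1 = ⊥
      · rw [h]; exact bot_le
      · have hi : (f.hom a.1, atomNorm a) ∈ s.pieces := (hW _).2 ⟨a, h, rfl⟩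
        refine s.le_toFun (i := ⟨_, hi⟩) ?_
        have h3 : f.hom (at' ⟨_, hi⟩).1 = f.hom a.1 := congrArg Prod.fst (h2 ⟨_, hi⟩)
        have h4 : at' ⟨_, hi⟩ = a := by
          by_contra hne
          have h5 := hdisj _ _ hne
          rw [h3, disjoint_self] at h5
          exact h h5
        show (at' ⟨_, hi⟩).1 ≤ x
        rw [h4]
        exact ha

instance : (diagram B).Final := by
  refine Functor.final_of_exists_of_isFiltered _ (fun d => ?_) fun {d s} u v => ?_
  · obtain ⟨s, g, hg⟩ := exists_factor d.hom
    exact ⟨s, ⟨CostructuredArrow.homMk g hg⟩⟩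
  · refine ⟨s, 𝟙 _, ?_⟩
    have : u = v := by
      ext : 2
      refine (cancel_mono s.toB).1 ?_
      exact (CostructuredArrow.w u).trans (CostructuredArrow.w v).symm
    rw [this]

end BoolP.Part

/-! ### Condensates -/

section Condensate

/-- The category `C` has all small directed colimits: every diagram indexed by a nonempty directed
poset has a colimit. -/
class HasDirectedColimits (C : Type w) [Category.{v} C] : Prop where
  hasColimitsOfShape : ∀ (I : Type u) [PartialOrder I] [Nonempty I] [IsDirectedOrder I],
    HasColimitsOfShape I C

/-- The functor `F` preserves all small directed colimits. -/
class PreservesDirectedColimits {C : Type w} [Category.{v} C] {D : Type*} [Category* D]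
    (F : C ⥤ D) : Prop where
  preservesColimitsOfShape : ∀ (I : Type u) [PartialOrder I] [Nonempty I] [IsDirectedOrder I],
    PreservesColimitsOfShape I F

variable {C : Type w} [Category.{v} C] [HasDirectedColimits.{u} C]

instance (F : CompactBoolP P ⥤ C) :
    (BoolP.IsCompact (P := P)).ι.HasPointwiseLeftKanExtension F := fun B => by
  have := HasDirectedColimits.hasColimitsOfShape (C := C) B.Part
  exact Functor.Final.hasColimit_of_comp (BoolP.Part.diagram B)

variable [HasBinaryProducts C]

/-- The functor `_ ⊗ S` on all `P`-scaled Boolean algebras, extending the one on compact algebras: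
`B ⊗ S` is the (filtered) colimit of all `K ⊗ S`, for `K` a compact algebra with a morphism to `B`.
The objects `B ⊗ S` are the condensates of `S`. -/
noncomputable def tensor (S : P ⥤ C) : BoolP P ⥤ C :=
  (BoolP.IsCompact (P := P)).ι.pointwiseLeftKanExtension (compactTensor S)

/-- The functor `_ ⊗ S` extends the functor defined on compact algebras. -/
noncomputable def tensorCompactIso (S : P ⥤ C) :
    compactTensor S ≅ (BoolP.IsCompact (P := P)).ι ⋙ tensor S :=
  @asIso _ _ _ _ ((BoolP.IsCompact (P := P)).ι.pointwiseLeftKanExtensionUnit (compactTensor S))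
    ((BoolP.IsCompact (P := P)).ι.pointwiseLeftKanExtensionIsPointwiseLeftKanExtension
      (compactTensor S)).isIso_hom

theorem two_atom_eq {p : P} (a b : At (compactTwo p)) : a = b := by
  obtain ⟨i, hi⟩ := Set.isAtom_iff.1 (show IsAtom (α := Set PUnit) a.1 from a.2)
  obtain ⟨j, hj⟩ := Set.isAtom_iff.1 (show IsAtom (α := Set PUnit) b.1 from b.2)
  exact Subtype.ext (hi.trans hj.symm)

theorem two_atomNorm {p : P} (a : At (compactTwo p)) : atomNorm a = p := by
  obtain ⟨i, hi⟩ := Set.isAtom_iff.1 (show IsAtom (α := Set PUnit) a.1 from a.2)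
  have h1 := (mem_two_scale p (atomNorm a) a.1).1 (atomNorm_spec a).1
  refine le_antisymm (h1 i (by rw [hi]; rfl)) ((atomNorm_spec a).2 ?_)
  exact (mem_two_scale p p a.1).2 fun _ _ => le_rfl

/-- The only atom of `2[p]`. -/
noncomputable def twoAtom (p : P) : At (compactTwo p) := Classical.arbitrary _

/-- The canonical isomorphism from the product over the only atom of `2[p]` to `S_p`. -/
noncomputable def piTwoIso (S : P ⥤ C) (p : P) :
    (∏ᶜ fun u : At (compactTwo p) => S.obj (atomNorm u)) ≅ S.obj p where
  hom := Pi.π (fun u : At (compactTwo p) => S.obj (atomNorm u)) (twoAtom p) ≫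
    S.map (homOfLE (two_atomNorm _).le)
  inv := Pi.lift fun u => S.map (homOfLE (two_atomNorm u).ge)
  hom_inv_id := by
    refine Pi.hom_ext _ _ fun u => ?_
    obtain rfl := two_atom_eq u (twoAtom p)
    rw [Category.assoc, Category.assoc, Pi.lift_π, ← S.map_comp, homOfLE_comp, Category.id_comp]
    exact (congrArg _ (S.map_id _)).trans (Category.comp_id _)
  inv_hom_id := by
    rw [Pi.lift_π_assoc, ← S.map_comp, homOfLE_comp]
    exact S.map_id _

/-- The canonical isomorphism from the compact tensor `2[p] ⊗ S` to `S_p`. -/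
noncomputable def compactTensorTwoIso (S : P ⥤ C) (p : P) :
    (compactTensor S).obj (compactTwo p) ≅ S.obj p := piTwoIso S p

/-- The canonical identification of `2[p] ⊗ S` with `S_p`. -/
noncomputable def tensorTwoIso (S : P ⥤ C) (p : P) : (tensor S).obj (two p) ≅ S.obj p :=
  ((tensorCompactIso S).app (compactTwo p)).symm ≪≫ compactTensorTwoIso S p

end Condensate

/-! ### Boolean algebras defined by generators and relations -/

/-- Boolean terms over a set `G` of generators. -/
inductive BTerm (G : Type u) : Type u
  | var : G → BTerm G
  | top : BTerm G
  | bot : BTerm G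
  | sup : BTerm G → BTerm G → BTerm G
  | inf : BTerm G → BTerm G → BTerm G
  | compl : BTerm G → BTerm G

/-- The finite join of the generators in a list. -/
def BTerm.join {G : Type u} : List G → BTerm G
  | [] => BTerm.bot
  | g :: l => BTerm.sup (BTerm.var g) (BTerm.join l)

/-- The inequalities between Boolean terms that follow, by the axioms of Boolean algebras, from the
inequalities `s ≤ t` with `R s t`. -/
inductive BTerm.Le {G : Type u} (R : BTerm G → BTerm G → Prop) : BTerm G → BTerm G → Prop
  | of (s t) : R s t → Le R s t
  | refl (s) : Le R s s
  | trans (s t r) : Le R s t → Le R t r → Le R s r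
  | bot_le (s) : Le R BTerm.bot s
  | le_top (s) : Le R s BTerm.top
  | left_le_sup (s t) : Le R s (BTerm.sup s t)
  | right_le_sup (s t) : Le R t (BTerm.sup s t)
  | sup_le (s t r) : Le R s r → Le R t r → Le R (BTerm.sup s t) r
  | inf_le_left (s t) : Le R (BTerm.inf s t) s
  | inf_le_right (s t) : Le R (BTerm.inf s t) t
  | le_inf (s t r) : Le R r s → Le R r t → Le R r (BTerm.inf s t)
  | distrib (s t r) : Le R (BTerm.inf (BTerm.sup s t) (BTerm.sup s r))
      (BTerm.sup s (BTerm.inf t r))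
  | inf_compl_le (s) : Le R (BTerm.inf s (BTerm.compl s)) BTerm.bot
  | top_le_sup_compl (s) : Le R BTerm.top (BTerm.sup s (BTerm.compl s))
  | compl_anti (s t) : Le R s t → Le R (BTerm.compl t) (BTerm.compl s)

section Presented

variable {G : Type u} (R : BTerm G → BTerm G → Prop)

/-- Two terms are identified if each one is below the other. -/
def presSetoid : Setoid (BTerm G) where
  r s t := BTerm.Le R s t ∧ BTerm.Le R t s
  iseqv :=
    { refl := fun s => ⟨.refl s, .refl s⟩
      symm := fun h => ⟨h.2, h.1⟩
      trans := fun h k => ⟨.trans _ _ _ h.1 k.1, .trans _ _ _ k.2 h.2⟩ }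

/-- The Boolean algebra defined by the set `G` of generators and the relations `s ≤ t` for
`R s t`. -/
def Pres : Type u := Quotient (presSetoid R)

variable {R} in
/-- The class of a term. -/
def Pres.mk (s : BTerm G) : Pres R := Quotient.mk (presSetoid R) s

instance : LE (Pres R) where
  le := Quotient.lift₂ (BTerm.Le R) fun _ _ _ _ h k => propext
    ⟨fun e => .trans _ _ _ h.2 (.trans _ _ _ e k.1),
      fun e => .trans _ _ _ h.1 (.trans _ _ _ e k.2)⟩

variable {R} in
theorem Pres.mk_le_mk {s t : BTerm G} : (Pres.mk s : Pres R) ≤ Pres.mk t ↔ BTerm.Le R s t :=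
  Iff.rfl

instance : BooleanAlgebra (Pres R) where
  le_refl := by rintro ⟨s⟩; exact .refl s
  le_trans := by rintro ⟨s⟩ ⟨t⟩ ⟨r⟩ h k; exact BTerm.Le.trans s t r h k
  le_antisymm := by rintro ⟨s⟩ ⟨t⟩ h k; exact Quotient.sound ⟨h, k⟩
  sup := Quotient.map₂ BTerm.sup fun _ _ h _ _ k =>
    ⟨.sup_le _ _ _ (.trans _ _ _ h.1 (.left_le_sup _ _)) (.trans _ _ _ k.1 (.right_le_sup _ _)),
      .sup_le _ _ _ (.trans _ _ _ h.2 (.left_le_sup _ _)) (.trans _ _ _ k.2 (.right_le_sup _ _))⟩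
  le_sup_left := by rintro ⟨s⟩ ⟨t⟩; exact .left_le_sup s t
  le_sup_right := by rintro ⟨s⟩ ⟨t⟩; exact .right_le_sup s t
  sup_le := by rintro ⟨s⟩ ⟨t⟩ ⟨r⟩ h k; exact .sup_le s t r h k
  inf := Quotient.map₂ BTerm.inf fun _ _ h _ _ k =>
    ⟨.le_inf _ _ _ (.trans _ _ _ (.inf_le_left _ _) h.1) (.trans _ _ _ (.inf_le_right _ _) k.1),
      .le_inf _ _ _ (.trans _ _ _ (.inf_le_left _ _) h.2) (.trans _ _ _ (.inf_le_right _ _) k.2)⟩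
  inf_le_left := by rintro ⟨s⟩ ⟨t⟩; exact .inf_le_left s t
  inf_le_right := by rintro ⟨s⟩ ⟨t⟩; exact .inf_le_right s t
  le_inf := by rintro ⟨s⟩ ⟨t⟩ ⟨r⟩ h k; exact .le_inf t r s h k
  le_sup_inf := by rintro ⟨s⟩ ⟨t⟩ ⟨r⟩; exact .distrib s t r
  compl := Quotient.map BTerm.compl fun _ _ h => ⟨.compl_anti _ _ h.2, .compl_anti _ _ h.1⟩
  top := Pres.mk BTerm.top
  bot := Pres.mk BTerm.bot
  inf_compl_le_bot := by rintro ⟨s⟩; exact .inf_compl_le s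
  top_le_sup_compl := by rintro ⟨s⟩; exact .top_le_sup_compl s
  le_top := by rintro ⟨s⟩; exact .le_top s
  bot_le := by rintro ⟨s⟩; exact .bot_le s

variable {R}

theorem Pres.mk_sup (s t : BTerm G) : (Pres.mk (.sup s t) : Pres R) = Pres.mk s ⊔ Pres.mk t := rfl

theorem Pres.mk_inf (s t : BTerm G) : (Pres.mk (.inf s t) : Pres R) = Pres.mk s ⊓ Pres.mk t := rfl

theorem Pres.mk_join_mem (K : Order.Ideal (Pres R)) (l : List G)
    (h : ∀ g ∈ l, (Pres.mk (.var g) : Pres R) ∈ K) : (Pres.mk (BTerm.join l) : Pres R) ∈ K := by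
  induction l with
  | nil => exact Order.Ideal.bot_mem K
  | cons g l ih =>
    exact Order.Ideal.sup_mem (h g (by simp)) (ih fun a ha => h a (by simp [ha]))

/-- The value of a Boolean term under an assignment of the generators. -/
def BTerm.eval {B : Type u} [BooleanAlgebra B] (f : G → B) : BTerm G → B
  | .var g => f g
  | .top => ⊤
  | .bot => ⊥
  | .sup s t => s.eval f ⊔ t.eval f
  | .inf s t => s.eval f ⊓ t.eval f
  | .compl s => (s.eval f)ᶜ

theorem BTerm.eval_le {B : Type u} [BooleanAlgebra B] (f : G → B)
    (h : ∀ s t, R s t → s.eval f ≤ t.eval f) {s t : BTerm G} (hst : BTerm.Le R s t) :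
    s.eval f ≤ t.eval f := by
  induction hst with
  | of s t hr => exact h s t hr
  | refl s => exact le_rfl
  | trans _ _ _ _ _ h1 h2 => exact h1.trans h2
  | bot_le _ => exact _root_.bot_le
  | le_top _ => exact _root_.le_top
  | left_le_sup _ _ => exact le_sup_left
  | right_le_sup _ _ => exact le_sup_right
  | sup_le _ _ _ _ _ h1 h2 => exact _root_.sup_le h1 h2
  | inf_le_left _ _ => exact _root_.inf_le_left
  | inf_le_right _ _ => exact _root_.inf_le_right
  | le_inf _ _ _ _ _ h1 h2 => exact _root_.le_inf h1 h2
  | distrib _ _ _ => exact le_sup_inf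
  | inf_compl_le _ => exact (inf_compl_eq_bot).le
  | top_le_sup_compl _ => exact sup_compl_eq_top.ge
  | compl_anti _ _ _ h1 => exact compl_le_compl h1

/-- The homomorphism induced by an assignment of the generators that satisfies the relations. -/
def Pres.lift {B : Type u} [BooleanAlgebra B] (f : G → B)
    (h : ∀ s t, R s t → s.eval f ≤ t.eval f) : BoundedLatticeHom (Pres R) B where
  toFun := Quotient.lift (BTerm.eval f) fun _ _ e =>
    le_antisymm (BTerm.eval_le f h e.1) (BTerm.eval_le f h e.2)
  map_sup' := by rintro ⟨s⟩ ⟨t⟩; rfl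
  map_inf' := by rintro ⟨s⟩ ⟨t⟩; rfl
  map_top' := rfl
  map_bot' := rfl

theorem Pres.lift_var {B : Type u} [BooleanAlgebra B] (f : G → B)
    (h : ∀ s t, R s t → s.eval f ≤ t.eval f) (g : G) : Pres.lift f h (Pres.mk (.var g)) = f g := rfl

theorem BTerm.eval_join_mem {ι : Type u} (f : G → Set ι) (l : List G) (i : ι) :
    i ∈ (BTerm.join l).eval f ↔ ∃ g ∈ l, i ∈ f g := by
  induction l with
  | nil => simp [BTerm.join, BTerm.eval]
  | cons g l ih =>
    change i ∈ f g ∪ (BTerm.join l).eval f ↔ _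
    simp [ih]

end Presented

/-! ### Norm-coverings and the algebras `F(X)` -/

variable (P) in
/-- A norm-covering of `P`: a (nonempty) pseudo join-semilattice with an isotone map to `P`. -/
structure NormCovering where
  /-- the underlying poset -/
  carrier : Type u
  [poset : PartialOrder carrier]
  [nonempty : Nonempty carrier]
  pjs : IsPseudoJoinSemilattice carrier
  /-- the map `∂` -/
  norm : carrier →o P

attribute [instance] NormCovering.poset NormCovering.nonempty

/-- The relations defining the Boolean algebra `F(X)` for a pseudo join-semilattice `X`:
`ṽ ≤ ũ` if `u ≤ v`; `ũ ∧ ṽ` is the join of all `w̃` with `w ∈ u ▽ v`; and `1` is the join of all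
`ũ` with `u` minimal in `X`. Finite joins are written along enumerations of finite sets. -/
inductive FRel (X : Type u) [PartialOrder X] : BTerm X → BTerm X → Prop
  | anti (u v : X) : u ≤ v → FRel X (.var v) (.var u)
  | inf_le_join (u v : X) (l : List X) : (∀ w, w ∈ l ↔ w ∈ minUpper {u, v}) →
      FRel X (.inf (.var u) (.var v)) (BTerm.join l)
  | join_le_inf (u v : X) (l : List X) : (∀ w, w ∈ l ↔ w ∈ minUpper {u, v}) →
      FRel X (BTerm.join l) (.inf (.var u) (.var v))
  | top_le_join (l : List X) : (∀ w, w ∈ l ↔ IsMin w) → FRel X .top (BTerm.join l)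

/-- The Boolean algebra `F(X)`. -/
abbrev FAlg (X : Type u) [PartialOrder X] : Type u := Pres (FRel X)

/-- The canonical generator `ũ` of `F(X)`. -/
def FAlg.gen {X : Type u} [PartialOrder X] (u : X) : FAlg X := Pres.mk (.var u)

/-- For an ideal `u` of a pseudo join-semilattice `X`, the assignment `v ↦ 1` if `v ∈ u` and
`v ↦ 0` otherwise satisfies the relations defining `F(X)`. -/
theorem ideal_relations {X : Type u} [PartialOrder X] (hX : IsPseudoJoinSemilattice X)
    (I : Order.Ideal X) (s t : BTerm X) (h : FRel X s t) :
    s.eval (fun v => ({_i | v ∈ I} : Set PUnit.{u + 1})) ≤ t.eval fun v => {_i | v ∈ I} := by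
  cases h with
  | anti u v h => exact fun _ hv => I.lower h hv
  | inf_le_join u v l hl =>
    rintro i ⟨hu, hv⟩
    obtain ⟨x, hx, hux, hvx⟩ := I.directed u hu v hv
    obtain ⟨m, hm, hmx⟩ := (hX.pair u v).2 x (by
      rintro y (rfl | rfl)
      · exact hux
      · exact hvx)
    exact (BTerm.eval_join_mem _ _ _).2 ⟨m, (hl m).2 hm, I.lower hmx hx⟩
  | join_le_inf u v l hl =>
    intro i hi
    obtain ⟨w, hw, hi⟩ := (BTerm.eval_join_mem _ _ _).1 hi
    have h1 : w ∈ upperBounds {u, v} := ((hl w).1 hw).1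
    exact ⟨I.lower (h1 (by simp)) hi, I.lower (h1 (by simp)) hi⟩
  | top_le_join l hl =>
    intro i _
    obtain ⟨x, hx⟩ := I.nonempty
    obtain ⟨m, hm, hmx⟩ := hX.empty.2 x
    exact (BTerm.eval_join_mem _ _ _).2 ⟨m, (hl m).2 hm, I.lower hmx hx⟩

/-- The homomorphism `π_u : F(X) → 2` with `π_u(ṽ) = 1` if `v ∈ u` and `π_u(ṽ) = 0` otherwise. -/
def idealHom {X : Type u} [PartialOrder X] (hX : IsPseudoJoinSemilattice X) (I : Order.Ideal X) :
    BoundedLatticeHom (FAlg X) (Set PUnit.{u + 1}) :=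
  Pres.lift (fun v => {_i | v ∈ I}) (ideal_relations hX I)

theorem nontrivial_FAlg {X : Type u} [PartialOrder X] [Nonempty X]
    (hX : IsPseudoJoinSemilattice X) : Nontrivial (FAlg X) := by
  refine ⟨⊥, ⊤, fun h => ?_⟩
  have h1 := congrArg (idealHom hX (Order.Ideal.principal (Classical.arbitrary X))) h
  rw [map_bot, map_top] at h1
  exact bot_ne_top h1

/-- The `P`-scaled Boolean algebra `F(X)` of a norm-covering `X` of `P`; its `p`-th ideal is
generated by all `ũ` with `p ≤ ∂u`. -/
def NormCovering.F (X : NormCovering P) : BoolP P where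
  carrier := FAlg X.carrier
  nontriv := nontrivial_FAlg X.pjs
  scale p := ⨆ u : {u : X.carrier // p ≤ X.norm u}, Order.Ideal.principal (FAlg.gen u.1)
  iSup_scale := by
    rw [← Order.Ideal.top_mem_iff_eq_top]
    obtain ⟨l, hl'⟩ : ∃ l : List X.carrier, ∀ w, w ∈ l ↔ IsMin w :=
      ⟨X.pjs.empty.1.toFinset.toList, fun w => by simp⟩
    have h1 : (⊤ : FAlg X.carrier) ≤ Pres.mk (BTerm.join l) :=
      BTerm.Le.of _ _ (FRel.top_le_join l hl')
    refine Order.Ideal.lower _ h1 (Pres.mk_join_mem _ l fun g _ => ?_)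
    refine le_iSup (fun p => ⨆ u : {u : X.carrier // p ≤ X.norm u},
      Order.Ideal.principal (FAlg.gen u.1)) (X.norm g) ?_
    refine le_iSup (fun u : {u : X.carrier // X.norm g ≤ X.norm u} =>
      Order.Ideal.principal (FAlg.gen u.1)) ⟨g, le_rfl⟩ ?_
    exact Order.Ideal.mem_principal_self
  scale_inf_scale p q := by
    apply le_antisymm
    · refine iSup_inf_iSup_le fun u v x hx => ?_
      obtain ⟨l, hl'⟩ : ∃ l : List X.carrier, ∀ w, w ∈ l ↔ w ∈ minUpper {u.1, v.1} :=
        ⟨(X.pjs.pair u.1 v.1).1.toFinset.toList, fun w => by simp⟩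
      have h1 : (FAlg.gen u.1 ⊓ FAlg.gen v.1 : FAlg X.carrier) ≤ Pres.mk (BTerm.join l) :=
        BTerm.Le.of _ _ (FRel.inf_le_join u.1 v.1 l hl')
      have h2 : x ≤ FAlg.gen u.1 ⊓ FAlg.gen v.1 :=
        le_inf (Order.Ideal.mem_principal.1 hx.1) (Order.Ideal.mem_principal.1 hx.2)
      refine Order.Ideal.lower _ (h2.trans h1) (Pres.mk_join_mem _ l fun w hw => ?_)
      have h3 : w ∈ upperBounds {u.1, v.1} := ((hl' w).1 hw).1
      have hu : u.1 ≤ w := h3 (by simp)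
      have hv : v.1 ≤ w := h3 (by simp)
      refine le_iSup (fun r : {r : P // p ≤ r ∧ q ≤ r} =>
        ⨆ u : {u : X.carrier // r.1 ≤ X.norm u}, Order.Ideal.principal (FAlg.gen u.1))
        ⟨X.norm w, u.2.trans (X.norm.monotone hu), v.2.trans (X.norm.monotone hv)⟩ ?_
      refine le_iSup (fun u : {u : X.carrier // X.norm w ≤ X.norm u} =>
        Order.Ideal.principal (FAlg.gen u.1)) ⟨w, le_rfl⟩ ?_
      exact Order.Ideal.mem_principal_self
    · refine iSup_le fun r => le_inf ?_ ?_
      · exact iSup_le fun u => le_iSup (fun u : {u : X.carrier // p ≤ X.norm u} =>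
          Order.Ideal.principal (FAlg.gen u.1)) ⟨u.1, r.2.1.trans u.2⟩
      · exact iSup_le fun u => le_iSup (fun u : {u : X.carrier // q ≤ X.norm u} =>
          Order.Ideal.principal (FAlg.gen u.1)) ⟨u.1, r.2.2.trans u.2⟩

/-- The set of all sharp ideals of a norm-covering `X`, ordered by containment: an ideal `x` of the
poset `X` is sharp if the set of all `∂u`, for `u ∈ x`, has a largest element. -/
abbrev SharpIdeal (X : NormCovering P) : Type u :=
  {I : Order.Ideal X.carrier // ∃ p, IsGreatest (X.norm '' (I : Set X.carrier)) p}

/-- `∂x`: the largest element of the set of all `∂u`, for `u` in the sharp ideal `x`. -/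
noncomputable def SharpIdeal.norm {X : NormCovering P} (x : SharpIdeal X) : P := x.2.choose

theorem SharpIdeal.norm_spec {X : NormCovering P} (x : SharpIdeal X) :
    IsGreatest (X.norm '' (x.1 : Set X.carrier)) x.norm := x.2.choose_spec

/-- The morphism `π_x : F(X) → 2[∂x]`, for a sharp ideal `x` of `X`. -/
noncomputable def SharpIdeal.π {X : NormCovering P} (x : SharpIdeal X) : X.F ⟶ two x.norm where
  hom := idealHom X.pjs x.1
  map_scale p := by
    have hs : ∀ a b, idealHom X.pjs x.1 (a ⊔ b) = idealHom X.pjs x.1 a ⊔ idealHom X.pjs x.1 b :=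
      map_sup _
    let K : Order.Ideal (FAlg X.carrier) :=
      Order.IsIdeal.toIdeal (I := {y | idealHom X.pjs x.1 y ∈ (two x.norm).scale p})
        { IsLowerSet := fun a b hba ha => Order.Ideal.lower ((two x.norm).scale p)
            (OrderHomClass.mono (idealHom X.pjs x.1) hba) ha
          Nonempty := ⟨⊥, (congrArg (· ∈ (two x.norm).scale p)
            (map_bot (idealHom X.pjs x.1))).mpr (Order.Ideal.bot_mem _)⟩
          Directed := fun a ha b hb => ⟨a ⊔ b, (congrArg (· ∈ (two x.norm).scale p)
            (hs a b)).mpr (Order.Ideal.sup_mem ha hb),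
            le_sup_left, le_sup_right⟩ }
    have h : X.F.scale p ≤ K := by
      refine iSup_le fun u => Order.Ideal.principal_le_iff.2 ?_
      refine (mem_two_scale _ _ _).2 fun i hi => ?_
      exact u.2.trans (x.norm_spec.2 ⟨u.1, hi, rfl⟩)
    exact fun y hy => h hy

/-! ### Lifters -/

/-- `𝒳^=`: the set of all members of `𝒳` whose norm is not maximal in `P`. -/
def nonmaximal {X : NormCovering P} (𝒳 : Set (SharpIdeal X)) : Set (SharpIdeal X) :=
  {x | x ∈ 𝒳 ∧ ¬ IsMax x.norm}

/-- The pair `(X, 𝒳)` is a `l`-lifter of `P`. -/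
structure IsLifter (l : Cardinal.{u}) (X : NormCovering P) (𝒳 : Set (SharpIdeal X)) : Prop where
  lower_small : ∀ x ∈ nonmaximal 𝒳, #{y : SharpIdeal X // y ∈ 𝒳 ∧ y ≤ x} < l.ord.cof
  exists_free : ∀ S : nonmaximal 𝒳 → {Z : Set X.carrier // #Z < l},
    ∃ σ : P →o 𝒳, (∀ p, (σ p).1.norm = p) ∧
      ∀ a b : P, a < b → ∃ ha : (σ a).1 ∈ nonmaximal 𝒳,
        (S ⟨(σ a).1, ha⟩).1 ∩ ((σ b).1.1 : Set X.carrier) ⊆ ((σ a).1.1 : Set X.carrier)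
  supported : l = ℵ₀ → IsSupported X.carrier

/-! ### Weakly presented objects -/

section WeaklyPresented

variable {C : Type w} [Category.{v} C]

/-- For an upper bound `m` of a subset `D` of a poset `I`, the cocone with vertex `F m`, given by
the transition morphisms, over the restriction of the diagram `F` to `D`. -/
def restrictCocone {I : Type u} [PartialOrder I] (F : I ⥤ C) (D : Set I) (m : I)
    (hm : m ∈ upperBounds D) : Cocone ((Subtype.mono_coe (· ∈ D)).functor ⋙ F) where
  pt := F.obj m
  ι :=
    { app := fun i => F.map (homOfLE (hm i.2))
      naturality := fun i j f => by
        refine (F.map_comp _ _).symm.trans ?_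
        exact (Category.comp_id _).symm }

/-- A diagram indexed by a poset `I` is continuous if it preserves all small directed colimits:
for every nonempty directed subset `D` of `I` with a least upper bound `m`, the object at `m`,
with the transition morphisms, is the colimit of the restriction of the diagram to `D`. -/
def IsContinuousDiagram {I : Type u} [PartialOrder I] (F : I ⥤ C) : Prop :=
  ∀ (D : Set I) (m : I), D.Nonempty → DirectedOn (· ≤ ·) D → ∀ hm : IsLUB D m,
    Nonempty (IsColimit (restrictCocone F D m hm.1))

/-- The poset of all subsets of `Ω` with fewer than `k` elements, ordered by containment. -/
abbrev SmallSubset (k : Cardinal.{u}) (Ω : Type u) : Type u := {Z : Set Ω // #Z < k}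

/-- The object `A` is weakly `k`-presented: for every set `Ω` and every continuous directed colimit
of a diagram indexed by the subsets of `Ω` with fewer than `k` elements, every morphism from `A` to
the colimit factors through some limiting morphism. -/
def WeaklyPresented (k : Cardinal.{u}) (A : C) : Prop :=
  ∀ (Ω : Type u) (B : SmallSubset k Ω ⥤ C), IsContinuousDiagram B →
    ∀ (c : Cocone B), Nonempty (IsColimit c) → ∀ f : A ⟶ c.pt,
      ∃ (Z : SmallSubset k Ω) (g : A ⟶ B.obj Z), f = g ≫ c.ι.app Z

end WeaklyPresented

/-! ### The morphisms `ρ` -/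

/-- `ρ_x = Φ(π_x ⊗ A) ∘ χ`, viewed as a morphism to `Φ(A_∂x)` through the canonical identification
of `2[∂x] ⊗ A` with `A_∂x`. -/
noncomputable def rho {𝒜 : Type*} [Category* 𝒜] {𝒮 : Type*} [Category* 𝒮]
    [HasDirectedColimits.{u} 𝒜] [HasBinaryProducts 𝒜] (Φ : 𝒜 ⥤ 𝒮) (A : P ⥤ 𝒜)
    {X : NormCovering P} {S : 𝒮} (χ : S ⟶ Φ.obj ((tensor A).obj X.F)) (x : SharpIdeal X) :
    S ⟶ Φ.obj (A.obj x.norm) :=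
  χ ≫ Φ.map ((tensor A).map x.π ≫ (tensorTwoIso A x.norm).hom)

end CLL

open CLL

/-! Write ρ_x for `rho Φ A χ x`. For p < q, naturality asks that ρ at σ(p), carried up to level q,
and ρ at σ(q) agree after composition with the structure morphism of `D.obj (σ p)`. The point is
that this composite sees only a small part of `X`. If T is weakly l-presented and g : T ⟶ Φ(F(X) ⊗
A), then there is a set V of fewer than l elements of `X` such that g followed by Φ(π_x ⊗ A)
depends, up to transition morphisms of A, only on the trace of x on V
(`WeaklyPresented.exists_support`). Attaching such a V to every nonmaximal member of `𝒳` and feeding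
this map to the lifter yields σ. For p < q, freeness and isotonicity say that σ(p) and σ(q) have the
same trace on the V attached to σ(p), which is the required equality.

To find V, write F(X) ⊗ A as a colimit of finite products, one for each labelled partition of the
unit of F(X). Weak presentability speaks of diagrams indexed by the subsets of size < l of a set Ω,
so the colimit has to be reindexed. An isotone choice of upper bounds (`exists_monotone_upperBound`)
turns the directed poset of partitions into a diagram on its finite subsets. Then a set Z of
partitions is sent to the colimit over the finite subsets of Z. On small Z this diagram is
continuous, also after Φ (`isContinuousDiagram_finColim`), and its colimit is the original one, so g
factors through a single Z (`WeaklyPresented.exists_small`).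

Only fewer than l partitions are then involved. Each has finitely many pieces, and each piece is a
Boolean term in finitely many generators (`exists_finite_support`). Taking V to be the set of all
these generators works: ideals with the same trace on V select the same atom of each compact algebra
involved (`BoolP.Part.pullAtom_toTwo_eq`), hence the same projection of the product. -/

namespace CLL

/-! ### Colimits over the finite subsets of a set -/

section FiniteSubsets

variable {Ω : Type u}

/-- The poset of all finite subsets of `W`, realized as finite subsets of the ambient type. -/
abbrev FinSub (W : Set Ω) : Type u := {F : Finset Ω // (F : Set Ω) ⊆ W}

instance (W : Set Ω) : Nonempty (FinSub W) := ⟨⟨∅, by simp⟩⟩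

instance (W : Set Ω) : IsDirectedOrder (FinSub W) := by
  classical
  exact ⟨fun F G => ⟨⟨F.1 ∪ G.1, by simpa using ⟨F.2, G.2⟩⟩,
    Finset.subset_union_left, Finset.subset_union_right⟩⟩

variable {C : Type w} [Category.{v} C]

/-- The restriction to the finite subsets of `W` of a diagram indexed by all finite subsets. -/
abbrev finRes (G : Finset Ω ⥤ C) (W : Set Ω) : FinSub W ⥤ C :=
  (Subtype.mono_coe fun F : Finset Ω => (F : Set Ω) ⊆ W).functor ⋙ G

/-- The restriction to the finite subsets of `V` of a cocone over the finite subsets of `W ⊇ V`. -/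
def finResCocone {G : Finset Ω ⥤ C} {V W : Set Ω} (h : V ⊆ W) (k : Cocone (finRes G W)) :
    Cocone (finRes G V) where
  pt := k.pt
  ι :=
    { app := fun F => k.ι.app ⟨F.1, F.2.trans h⟩
      naturality := fun F F' f =>
        k.ι.naturality (X := ⟨F.1, F.2.trans h⟩) (Y := ⟨F'.1, F'.2.trans h⟩)
          (homOfLE (leOfHom f)) }

variable [HasDirectedColimits.{u} C]

instance (G : Finset Ω ⥤ C) (W : Set Ω) : HasColimit (finRes G W) := by
  have := HasDirectedColimits.hasColimitsOfShape (C := C) (FinSub W)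
  infer_instance

/-- The diagram of all colimits over the finite subsets of `W`, for `W` a subset of `Ω`. -/
noncomputable def finColim (G : Finset Ω ⥤ C) : Set Ω ⥤ C where
  obj W := colimit (finRes G W)
  map h := colimit.desc _ (finResCocone (leOfHom h) (colimit.cocone _))
  map_id W := by
    refine colimit.hom_ext fun F => ?_
    rw [colimit.ι_desc]
    exact (Category.comp_id _).symm
  map_comp {U V W} f g := by
    refine colimit.hom_ext fun F => ?_
    rw [colimit.ι_desc]
    refine Eq.symm ((colimit.ι_desc_assoc _ _ _).trans ?_)
    exact colimit.ι_desc (finResCocone (leOfHom g) (colimit.cocone (finRes G W)))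
      ⟨F.1, F.2.trans (leOfHom f)⟩

/-- A cocone over the finite subsets of `W` induces a cocone over any diagram of subsets of `W`. -/
noncomputable def finColimCocone {G : Finset Ω ⥤ C} {J : Type u} [Preorder J] {φ : J → Set Ω}
    (hφ : Monotone φ) {W : Set Ω} (hW : ∀ j, φ j ⊆ W) (k : Cocone (finRes G W)) :
    Cocone (hφ.functor ⋙ finColim G) where
  pt := k.pt
  ι :=
    { app := fun j => colimit.desc _ (finResCocone (hW j) k)
      naturality := fun i j f => by
        refine colimit.hom_ext fun F => ?_
        refine (colimit.ι_desc_assoc _ _ _).trans ?_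
        refine (colimit.ι_desc (finResCocone (hW j) k) ⟨F.1, F.2.trans (hφ (leOfHom f))⟩).trans ?_
        refine Eq.trans ?_ (congrArg _ (Category.comp_id _).symm)
        exact (colimit.ι_desc (finResCocone (hW i) k) F).symm }

theorem ι_finColimCocone {G : Finset Ω ⥤ C} {J : Type u} [Preorder J] {φ : J → Set Ω}
    (hφ : Monotone φ) {W : Set Ω} (hW : ∀ j, φ j ⊆ W) (k : Cocone (finRes G W)) (j : J)
    (F : FinSub (φ j)) : colimit.ι (finRes G (φ j)) F ≫ (finColimCocone hφ hW k).ι.app j =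
      k.ι.app ⟨F.1, F.2.trans (hW j)⟩ :=
  colimit.ι_desc _ _

/-- If every finite subset of `W` is contained in a member of a directed family of subsets of `W`,
then the colimit over the finite subsets of `W` is the colimit along the family. -/
theorem nonempty_isColimit_finColimCocone {G : Finset Ω ⥤ C} {J : Type u} [Preorder J]
    [IsDirectedOrder J] {φ : J → Set Ω} (hφ : Monotone φ) {W : Set Ω} (hW : ∀ j, φ j ⊆ W)
    (hcov : ∀ F : FinSub W, ∃ j, (F.1 : Set Ω) ⊆ φ j) {k : Cocone (finRes G W)}
    (hk : IsColimit k) : Nonempty (IsColimit (finColimCocone hφ hW k)) := by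
  choose r hr using hcov
  -- The choice `r` is not coherent in `F`. It does no harm: any two members of the family
  -- containing `F` lie below a third, where the two legs can be compared.
  have hleg : ∀ (s : Cocone (hφ.functor ⋙ finColim G)) (F : Finset Ω) (i j : J)
      (hi : (F : Set Ω) ⊆ φ i) (hj : (F : Set Ω) ⊆ φ j),
      colimit.ι (finRes G (φ i)) ⟨F, hi⟩ ≫ s.ι.app i =
        colimit.ι (finRes G (φ j)) ⟨F, hj⟩ ≫ s.ι.app j := by
    intro s F
    have key : ∀ (i j : J) (hij : i ≤ j) (hi : (F : Set Ω) ⊆ φ i),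
        colimit.ι (finRes G (φ i)) ⟨F, hi⟩ ≫ s.ι.app i =
          colimit.ι (finRes G (φ j)) ⟨F, hi.trans (hφ hij)⟩ ≫ s.ι.app j := by
      intro i j hij hi
      rw [← s.w (homOfLE hij)]
      exact colimit.ι_desc_assoc _ _ _
    intro i j hi hj
    obtain ⟨l, hil, hjl⟩ := exists_ge_ge i j
    rw [key i l hil hi, key j l hjl hj]
  let d : ∀ s : Cocone (hφ.functor ⋙ finColim G), Cocone (finRes G W) := fun s =>
    { pt := s.pt
      ι :=
        { app := fun F => colimit.ι (finRes G (φ (r F))) ⟨F.1, hr F⟩ ≫ s.ι.app (r F)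
          naturality := fun F F' f => by
            -- `r F` and `r F'` need not be comparable, so both legs are moved to `φ (r F')`, which
            -- contains `F` as well as `F'`.
            have h1 : (F.1 : Set Ω) ⊆ φ (r F') :=
              (Finset.coe_subset.2 (leOfHom f)).trans (hr F')
            refine Eq.trans ?_ ((hleg s F.1 (r F') (r F) h1 (hr F)).trans
              (Category.comp_id _).symm)
            refine (Category.assoc _ _ _).symm.trans (congrArg (· ≫ s.ι.app (r F')) ?_)
            exact (colimit.cocone (finRes G (φ (r F')))).w
              (homOfLE (show (⟨F.1, h1⟩ : FinSub _) ≤ ⟨F'.1, hr F'⟩ from leOfHom f)) } }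
  refine ⟨{ desc := fun s => hk.desc (d s), fac := fun s j => ?_, uniq := fun s m hm => ?_ }⟩
  · refine colimit.hom_ext fun F => ?_
    have h1 := ι_finColimCocone hφ hW k j F
    refine (Category.assoc _ _ _).symm.trans ((congrArg (· ≫ _) h1).trans ?_)
    refine (hk.fac (d s) _).trans ?_
    exact hleg s F.1 _ _ _ _
  · refine hk.uniq (d s) m fun F => ?_
    have h1 := ι_finColimCocone hφ hW k (r F) ⟨F.1, hr F⟩
    refine (congrArg (· ≫ m) h1.symm).trans ((Category.assoc _ _ _).trans ?_)
    exact congrArg _ (hm (r F))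

/-! ### Continuity of the colimit diagram on small subsets -/

/-- The union lies inside `m`, so it is itself small and competes as an upper bound of `D`.
Continuity thus only has to be tested on genuine unions. -/
theorem SmallSubset.eq_biUnion_of_isLUB {l : Cardinal.{u}} {D : Set (SmallSubset l Ω)}
    {m : SmallSubset l Ω} (hm : IsLUB D m) : m.1 = ⋃ Z ∈ D, Z.1 := by
  have hsub : (⋃ Z ∈ D, Z.1) ⊆ m.1 := Set.iUnion₂_subset fun Z hZ => hm.1 hZ
  refine subset_antisymm ?_ hsub
  let U : SmallSubset l Ω := ⟨⋃ Z ∈ D, Z.1, (mk_le_mk_of_subset hsub).trans_lt m.2⟩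
  have hU : U ∈ upperBounds D := fun Z hZ =>
    Set.subset_biUnion_of_mem (u := fun Z : SmallSubset l Ω => Z.1) hZ
  exact hm.2 hU

/-- A finite subset of a directed union is contained in one of its members, so the finite subsets of
the members exhaust those of the union. The resulting colimit is indexed by a directed poset, hence
survives `Φ`. -/
theorem isContinuousDiagram_finColim {S : Type*} [Category* S] (l : Cardinal.{u})
    (G : Finset Ω ⥤ C) (Φ : C ⥤ S) [PreservesDirectedColimits.{u} Φ] :
    IsContinuousDiagram
      (((Subtype.mono_coe fun Z : Set Ω => #Z < l).functor ⋙ finColim G) ⋙ Φ) := by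
  intro D m hne hdir hm
  have : Nonempty D := hne.to_subtype
  have : IsDirectedOrder D := ⟨fun a b => by
    obtain ⟨c, hc, h1, h2⟩ := hdir a.1 a.2 b.1 b.2
    exact ⟨⟨c, hc⟩, h1, h2⟩⟩
  have := PreservesDirectedColimits.preservesColimitsOfShape (F := Φ) D
  have hφ : Monotone fun d : D => d.1.1 := fun _ _ h => h
  have hW : ∀ d : D, d.1.1 ⊆ m.1 := fun d => hm.1 d.2
  have hcov : ∀ F : FinSub m.1, ∃ d : D, (F.1 : Set Ω) ⊆ d.1.1 := by
    intro F
    have h1 : ∀ ω ∈ F.1, ∃ d : D, ω ∈ d.1.1 := fun ω hω => by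
      have h2 := F.2 hω
      rw [SmallSubset.eq_biUnion_of_isLUB hm] at h2
      obtain ⟨d, hd, h⟩ := Set.mem_iUnion₂.1 h2
      exact ⟨⟨d, hd⟩, h⟩
    choose! e he using h1
    classical
    obtain ⟨d, hd⟩ := (F.1.image e).exists_le
    exact ⟨d, fun ω hω => hd (e ω) (Finset.mem_image_of_mem e hω) (he ω hω)⟩
  obtain ⟨h⟩ := nonempty_isColimit_finColimCocone hφ hW hcov (colimit.isColimit (finRes G m.1))
  -- This cocone and `restrictCocone` have the same vertex and the same legs; only their
  -- presentation differs.
  exact ⟨IsColimit.ofIsoColimit (isColimitOfPreserves Φ h) (Cocone.ext (Iso.refl _) fun d =>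
    Category.comp_id _)⟩

/-- A morphism from a weakly `l`-presented object to the image of a colimit over finite subsets is
determined by fewer than `l` elements. -/
theorem WeaklyPresented.exists_small {S : Type*} [Category* S] {l : Cardinal.{u}} (hl : ℵ₀ ≤ l)
    {T : S} (hT : WeaklyPresented l T) (G : Finset Ω ⥤ C) (Φ : C ⥤ S)
    [PreservesDirectedColimits.{u} Φ] {k : Cocone (finRes G Set.univ)} (hk : IsColimit k)
    (g : T ⟶ Φ.obj k.pt) : ∃ Z : SmallSubset l Ω, ∀ (E : C) (a b : k.pt ⟶ E),
      (∀ F : FinSub Z.1, k.ι.app ⟨F.1, Set.subset_univ _⟩ ≫ a =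
        k.ι.app ⟨F.1, Set.subset_univ _⟩ ≫ b) → g ≫ Φ.map a = g ≫ Φ.map b := by
  have hφ : Monotone fun Z : SmallSubset l Ω => Z.1 := fun _ _ h => h
  have : Nonempty (SmallSubset l Ω) :=
    ⟨⟨∅, by rw [mk_eq_zero]; exact aleph0_pos.trans_le hl⟩⟩
  have : IsDirectedOrder (SmallSubset l Ω) := ⟨fun a b => ⟨⟨a.1 ∪ b.1,
    (mk_union_le _ _).trans_lt (add_lt_of_lt hl a.2 b.2)⟩,
    Set.subset_union_left, Set.subset_union_right⟩⟩
  have := PreservesDirectedColimits.preservesColimitsOfShape (F := Φ) (SmallSubset l Ω)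
  -- Since `l` is infinite, every finite subset is itself a small subset, so the small subsets
  -- cover.
  obtain ⟨h⟩ := nonempty_isColimit_finColimCocone hφ (fun Z => Set.subset_univ _)
    (fun F : FinSub Set.univ => ⟨⟨F.1, (lt_aleph0_of_finite _).trans_le hl⟩, subset_rfl⟩) hk
  obtain ⟨Z, f, hf⟩ := hT Ω _ (isContinuousDiagram_finColim l G Φ)
    (Φ.mapCocone (finColimCocone hφ (fun Z => Set.subset_univ _) k))
    ⟨isColimitOfPreserves Φ h⟩ g
  refine ⟨Z, fun E a b hab => ?_⟩
  -- The object at `Z` is a colimit over the finite subsets of `Z`, where `a` and `b` agree by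
  -- assumption; `g` factors through its image.
  have key : (finColimCocone hφ (fun Z => Set.subset_univ _) k).ι.app Z ≫ a =
      (finColimCocone hφ (fun Z => Set.subset_univ _) k).ι.app Z ≫ b := by
    refine colimit.hom_ext fun F => ?_
    have h1 := ι_finColimCocone hφ (fun Z => Set.subset_univ _) k Z F
    refine (Category.assoc _ _ _).symm.trans ((congrArg (· ≫ a) h1).trans ?_)
    refine Eq.trans ?_ ((congrArg (· ≫ b) h1.symm).trans (Category.assoc _ _ _))
    exact hab F
  rw [hf]
  refine (Category.assoc _ _ _).trans (Eq.trans ?_ (Category.assoc _ _ _).symm)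
  refine congrArg (f ≫ ·) ?_
  exact (Φ.map_comp _ _).symm.trans ((congrArg Φ.map key).trans (Φ.map_comp _ _))

end FiniteSubsets

/-! ### Reindexing a directed poset by its finite subsets -/

/-- Every directed poset admits an isotone map from its finite subsets that sends each finite
subset to an upper bound. -/
theorem exists_monotone_upperBound (I : Type u) [PartialOrder I] [Nonempty I] [IsDirectedOrder I] :
    ∃ f : Finset I → I, Monotone f ∧ ∀ F, ∀ i ∈ F, i ≤ f F := by
  classical
  have hub : ∀ A : Finset I, ∃ m, ∀ i ∈ A, i ≤ m := fun A => A.exists_le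
  choose ub hub using hub
  -- Recursion along strict inclusion: `f F` bounds the elements of `F` and also all values `f G`
  -- with `G` a proper subset of `F`, which makes `f` isotone.
  let f : Finset I → I := fun F => Finset.strongInduction
    (fun F r => ub (F ∪ F.ssubsets.attach.image fun G => r G.1 (Finset.mem_ssubsets.1 G.2))) F
  have hf : ∀ F, f F = ub (F ∪ F.ssubsets.attach.image fun G => f G.1) := fun F =>
    Finset.strongInduction_eq _ F
  refine ⟨f, fun F G h => ?_, fun F i hi => ?_⟩
  · rcases h.eq_or_lt with rfl | h
    · exact le_rfl
    · rw [hf G]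
      exact hub _ _ (Finset.mem_union_right _ (Finset.mem_image.2
        ⟨⟨F, Finset.mem_ssubsets.2 h⟩, Finset.mem_attach _ _, rfl⟩))
  · rw [hf F]
    exact hub _ _ (Finset.mem_union_left _ hi)

/-! ### Supports of elements of `F(X)` -/

/-- A term involves finitely many generators, and `idealHom hX I` evaluates it at the indicator of
`I`. The set `V` depends on the chosen term, but any representative of `b` will do. -/
theorem exists_finite_support {X : Type u} [PartialOrder X] (hX : IsPseudoJoinSemilattice X)
    (b : FAlg X) : ∃ V : Set X, V.Finite ∧ ∀ I J : Order.Ideal X, (∀ v ∈ V, v ∈ I ↔ v ∈ J) →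
      idealHom hX I b = idealHom hX J b := by
  obtain ⟨t, rfl⟩ := Quotient.exists_rep b
  have key : ∃ V : Set X, V.Finite ∧ ∀ I J : Order.Ideal X, (∀ v ∈ V, v ∈ I ↔ v ∈ J) →
      t.eval (fun v => ({_i | v ∈ I} : Set PUnit.{u + 1})) = t.eval fun v => {_i | v ∈ J} := by
    induction t with
    | var v =>
      refine ⟨{v}, Set.finite_singleton v, fun I J h => ?_⟩
      simp [BTerm.eval, h v rfl]
    | top => exact ⟨∅, Set.finite_empty, fun _ _ _ => rfl⟩
    | bot => exact ⟨∅, Set.finite_empty, fun _ _ _ => rfl⟩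
    | sup s t hs ht =>
      obtain ⟨V, hV, h1⟩ := hs
      obtain ⟨W, hW, h2⟩ := ht
      exact ⟨V ∪ W, hV.union hW, fun I J h => congrArg₂ (· ⊔ ·)
        (h1 I J fun v hv => h v (Or.inl hv)) (h2 I J fun v hv => h v (Or.inr hv))⟩
    | inf s t hs ht =>
      obtain ⟨V, hV, h1⟩ := hs
      obtain ⟨W, hW, h2⟩ := ht
      exact ⟨V ∪ W, hV.union hW, fun I J h => congrArg₂ (· ⊓ ·)
        (h1 I J fun v hv => h v (Or.inl hv)) (h2 I J fun v hv => h v (Or.inr hv))⟩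
    | compl s hs =>
      obtain ⟨V, hV, h1⟩ := hs
      exact ⟨V, hV, fun I J h => congrArg (·ᶜ) (h1 I J h)⟩
  exact key

variable {P : Type u} [PartialOrder P]

/-- Every element in the image of `s.toFun` is a join of pieces, so the supports of the finitely
many pieces suffice for all of them at once. -/
theorem BoolP.Part.exists_finite_support {X : NormCovering P} (s : X.F.Part) :
    ∃ V : Set X.carrier, V.Finite ∧ ∀ I J : Order.Ideal X.carrier, (∀ v ∈ V, v ∈ I ↔ v ∈ J) →
      ∀ x : Set s.pieces, idealHom X.pjs I (s.toFun x) = idealHom X.pjs J (s.toFun x) := by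
  classical
  choose V hV h using CLL.exists_finite_support X.pjs
  refine ⟨⋃ i : s.pieces, V i.1.1, Set.finite_iUnion fun i => hV _, fun I J hIJ x => ?_⟩
  let e : s.pieces → FAlg X.carrier := fun i => i.1.1
  refine (map_finset_sup (idealHom X.pjs I) _ e).trans
    (Eq.trans ?_ (map_finset_sup (idealHom X.pjs J) _ e).symm)
  exact Finset.sup_congr rfl fun i _ => h i.1.1 I J fun v hv =>
    hIJ v (Set.mem_iUnion.2 ⟨i, hv⟩)

/-! ### Cardinality bounds -/

/-- Finiteness of the sets replaces regularity of `l`: a finite index gives a finite union, and an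
infinite one gives at most `#ι * ℵ₀ = #ι` elements. -/
theorem mk_iUnion_lt_of_finite {ι α : Type u} {l : Cardinal.{u}} (hl : ℵ₀ ≤ l) (hι : #ι < l)
    (V : ι → Set α) (hV : ∀ i, (V i).Finite) : #(⋃ i, V i : Set α) < l := by
  rcases lt_or_ge #ι ℵ₀ with h | h
  · have : Finite ι := lt_aleph0_iff_finite.1 h
    exact (Set.finite_iUnion hV).lt_aleph0.trans_le hl
  · refine (mk_iUnion_le V).trans_lt ?_
    refine (mul_le_mul_right (ciSup_le' fun i => (hV i).lt_aleph0.le) _).trans_lt ?_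
    rwa [mul_aleph0_eq h]

/-- An infinite set has only as many finite subsets as elements, and a finite set has finitely many.
-/
theorem mk_finSub_lt {Ω : Type u} {l : Cardinal.{u}} (hl : ℵ₀ ≤ l) (Z : SmallSubset l Ω) :
    #(FinSub Z.1) < l := by
  classical
  have h1 : #(FinSub Z.1) ≤ #(Finset Z.1) :=
    mk_le_of_injective (f := fun F : FinSub Z.1 => F.1.subtype (· ∈ Z.1)) fun F G h =>
      Subtype.ext (Finset.ext fun i => by
        constructor
        · intro hi
          have h2 : (⟨i, F.2 hi⟩ : Z.1) ∈ F.1.subtype (· ∈ Z.1) := Finset.mem_subtype.2 hi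
          exact Finset.mem_subtype.1 ((congrArg ((⟨i, F.2 hi⟩ : Z.1) ∈ ·) h).mp h2)
        · intro hi
          have h2 : (⟨i, G.2 hi⟩ : Z.1) ∈ G.1.subtype (· ∈ Z.1) := Finset.mem_subtype.2 hi
          exact Finset.mem_subtype.1 ((congrArg ((⟨i, G.2 hi⟩ : Z.1) ∈ ·) h).mpr h2))
  refine h1.trans_lt ?_
  rcases finite_or_infinite Z.1 with h | h
  · exact (lt_aleph0_of_finite _).trans_le hl
  · rw [mk_finset_of_infinite]
    exact Z.2

/-! ### Condensates as colimits over finite sets of partitions -/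

section Condensate

variable {C : Type w} [Category.{v} C] [HasDirectedColimits.{u} C] [HasBinaryProducts C]

/-- The tensors of the compact algebras attached to a family of partitions. -/
noncomputable abbrev partTensor (A : P ⥤ C) (B : BoolP P) {f : Finset B.Part → B.Part}
    (hf : Monotone f) : Finset B.Part ⥤ C :=
  hf.functor ⋙ BoolP.Part.diagram B ⋙ CostructuredArrow.proj _ B ⋙ compactTensor A

/-- The canonical cocone over the tensors of the compact algebras attached to partitions. -/
noncomputable def partTensorCocone (A : P ⥤ C) (B : BoolP P) {f : Finset B.Part → B.Part}
    (hf : Monotone f) : Cocone (finRes (partTensor A B hf) Set.univ) :=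
  ((Functor.LeftExtension.mk _ ((BoolP.IsCompact (P := P)).ι.pointwiseLeftKanExtensionUnit
    (compactTensor A))).coconeAt B).whisker
      (((Subtype.mono_coe fun F : Finset B.Part => (F : Set B.Part) ⊆ Set.univ).functor ⋙
        hf.functor) ⋙ BoolP.Part.diagram B)

/-- The condensate is a pointwise Kan extension, that is, a colimit over the compact algebras above
`B`. Partitions are final among these, and finite sets of partitions are final among partitions
along `f`. -/
theorem nonempty_isColimit_partTensorCocone (A : P ⥤ C) (B : BoolP P)
    {f : Finset B.Part → B.Part} (hf : Monotone f) (hf' : ∀ F, ∀ i ∈ F, i ≤ f F) :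
    Nonempty (IsColimit (partTensorCocone A B hf)) := by
  have h1 : ((Subtype.mono_coe fun F : Finset B.Part => (F : Set B.Part) ⊆ Set.univ).functor ⋙
      hf.functor).Final := by
    refine Functor.final_of_exists_of_isFiltered _ (fun s => ?_) fun {s F} a b => ?_
    -- Finality of `f`: each `s` lies below `f {s}`, and parallel morphisms in a poset are equal.
    · exact ⟨⟨{s}, Set.subset_univ _⟩, ⟨homOfLE (hf' {s} s (Finset.mem_singleton_self s))⟩⟩
    · exact ⟨F, 𝟙 F, Subsingleton.elim _ _⟩
  exact ⟨(Functor.Final.isColimitWhiskerEquiv _ _).symm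
    ((BoolP.IsCompact (P := P)).ι.pointwiseLeftKanExtensionIsPointwiseLeftKanExtension
      (compactTensor A) B)⟩

/-- The morphism from a compact tensor to `A_p` induced by a morphism to `2[p]` is a projection
followed by a transition morphism. -/
theorem tensorCompactIso_map_tensorTwoIso (A : P ⥤ C) {K : CompactBoolP P} {p : P}
    (ψ : K ⟶ compactTwo p) :
    (tensorCompactIso A).hom.app K ≫ (tensor A).map ψ.hom ≫ (tensorTwoIso A p).hom =
      Pi.π (fun u : At K => A.obj (atomNorm u)) (pullAtom ψ (twoAtom p)) ≫
        A.map (homOfLE ((atomNorm_pullAtom_le ψ (twoAtom p)).trans (two_atomNorm _).le)) := by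
  have h1 : (tensorCompactIso A).hom.app K ≫ (tensor A).map ψ.hom =
      (compactTensor A).map ψ ≫ (tensorCompactIso A).hom.app (compactTwo p) :=
    ((tensorCompactIso A).hom.naturality ψ).symm
  -- The identification of `2[p] ⊗ A` with `A_p` begins with the inverse of this very morphism,
  -- which therefore cancels.
  have h2 : (tensorCompactIso A).hom.app (compactTwo p) ≫ (tensorTwoIso A p).hom =
      (compactTensorTwoIso A p).hom :=
    ((tensorCompactIso A).app (compactTwo p)).hom_inv_id_assoc _
  refine (Category.assoc _ _ _).symm.trans ((congrArg (· ≫ _) h1).trans ?_)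
  refine (Category.assoc _ _ _).trans ((congrArg _ h2).trans ?_)
  refine (Category.assoc _ _ _).symm.trans ?_
  refine (congrArg (· ≫ _) (Pi.lift_π _ _)).trans ?_
  exact (Category.assoc _ _ _).trans (congrArg _ (A.map_comp _ _).symm)

/-- The composite of the canonical morphism from a compact algebra with `π_x`. -/
noncomputable def BoolP.Part.toTwo {X : NormCovering P} (s : X.F.Part) (x : SharpIdeal X) :
    s.compact ⟶ compactTwo x.norm := ObjectProperty.homMk (s.toB ≫ x.π)

/-- The pulled-back atom depends only on the underlying Boolean homomorphism, not on the scaling of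
the target. Hence it can be compared for `x` and `y` even when their norms differ. -/
theorem BoolP.Part.pullAtom_toTwo_eq {X : NormCovering P} (s : X.F.Part) {x y : SharpIdeal X}
    (h : ∀ a : Set s.pieces, idealHom X.pjs x.1 (s.toFun a) = idealHom X.pjs y.1 (s.toFun a)) :
    pullAtom (s.toTwo x) (twoAtom _) = pullAtom (s.toTwo y) (twoAtom _) := by
  refine eq_pullAtom _ _ _ ?_
  have h1 := le_pullAtom (s.toTwo x) (twoAtom _)
  -- For every `p`, the atom of `2[p]` is its unit, so the two atoms are the same set.
  have h2 : ∀ p : P, (twoAtom p).1 = (Set.univ : Set PUnit.{u + 1}) := fun p => by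
    obtain ⟨i, hi⟩ := Set.isAtom_iff.1 (show IsAtom (α := Set PUnit) (twoAtom p).1 from
      (twoAtom p).2)
    exact hi.trans (Set.eq_univ_of_forall fun j => Subsingleton.elim j i)
  have h3 : (Set.univ : Set PUnit.{u + 1}) ≤
      idealHom X.pjs x.1 (s.toFun (pullAtom (s.toTwo x) (twoAtom _)).1) :=
    (h2 _).symm.le.trans h1
  exact (h2 _).le.trans (h3.trans (h _).le)

/-- A morphism from a weakly `l`-presented object to the image of the condensate `F(X) ⊗ A` depends
on fewer than `l` elements of `X`, as far as the morphisms `π_x ⊗ A` are concerned. -/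
theorem WeaklyPresented.exists_support {S : Type*} [Category* S] {l : Cardinal.{u}} (hl : ℵ₀ ≤ l)
    {T : S} (hT : WeaklyPresented l T) (A : P ⥤ C) (Φ : C ⥤ S) [PreservesDirectedColimits.{u} Φ]
    {X : NormCovering P} (g : T ⟶ Φ.obj ((tensor A).obj X.F)) :
    ∃ V : {V : Set X.carrier // #V < l}, ∀ (x y : SharpIdeal X) (hxy : x.norm ≤ y.norm),
      (∀ v ∈ V.1, v ∈ x.1 ↔ v ∈ y.1) →
        g ≫ Φ.map (((tensor A).map x.π ≫ (tensorTwoIso A x.norm).hom) ≫ A.map (homOfLE hxy)) =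
          g ≫ Φ.map ((tensor A).map y.π ≫ (tensorTwoIso A y.norm).hom) := by
  -- Here Ω is the set of all labelled partitions of the unit of F(X).
  obtain ⟨f, hf, hf'⟩ := exists_monotone_upperBound X.F.Part
  obtain ⟨hk⟩ := nonempty_isColimit_partTensorCocone A X.F hf hf'
  obtain ⟨Z, hZ⟩ := hT.exists_small hl _ Φ hk g
  choose V hV h using BoolP.Part.exists_finite_support (X := X)
  -- The supports are those of the partitions `f F` with `F ⊆ Z` finite, since the compact algebra
  -- placed at `F` is that of `f F`.
  refine ⟨⟨⋃ F : FinSub Z.1, V (f F.1), mk_iUnion_lt_of_finite hl (mk_finSub_lt hl Z) _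
    fun F => hV _⟩, fun x y hxy hV => hZ _ _ _ fun F => ?_⟩
  -- On the stage `F`, the morphism π_z ⊗ A is the projection at the atom selected by `z`, followed
  -- by a transition morphism.
  have h1 : ∀ z : SharpIdeal X, (partTensorCocone A X.F hf).ι.app ⟨F.1, Set.subset_univ _⟩ ≫
      (tensor A).map z.π ≫ (tensorTwoIso A z.norm).hom =
      Pi.π (fun u : At (f F.1).compact => A.obj (atomNorm u))
        (pullAtom ((f F.1).toTwo z) (twoAtom _)) ≫
        A.map (homOfLE ((atomNorm_pullAtom_le _ (twoAtom z.norm)).trans (two_atomNorm _).le)) := by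
    intro z
    rw [← tensorCompactIso_map_tensorTwoIso]
    refine (Category.assoc _ _ _).trans (congrArg _ ?_)
    exact (Category.assoc _ _ _).symm.trans
      (congrArg (· ≫ _) ((tensor A).map_comp (f F.1).toB z.π).symm)
  have h2 := (f F.1).pullAtom_toTwo_eq (x := x) (y := y) (h (f F.1) x.1 y.1 fun v hv =>
    hV v (Set.mem_iUnion.2 ⟨F, hv⟩))
  refine Eq.trans ?_ (h1 y).symm
  refine (Category.assoc _ _ _).symm.trans ((congrArg (· ≫ _) (h1 x)).trans ?_)
  refine (Category.assoc _ _ _).trans (Eq.trans (congrArg _ (A.map_comp _ _).symm) ?_)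
  -- Both sides are now the projection at one and the same atom, followed by the transition up to
  -- level `y.norm`.
  exact π_map_eq h2 _ _

end Condensate

end CLL

/-! ### Choice of σ and naturality -/

theorem lemmaL {P : Type u} [PartialOrder P]
    (l : Cardinal.{u}) (hl : ℵ₀ ≤ l)
    (X : NormCovering P) (𝒳 : Set (SharpIdeal X)) (hX : IsLifter l X 𝒳)
    {𝒜 : Type u₁} [Category.{v₁} 𝒜] {𝒮 : Type u₂} [Category.{v₂} 𝒮] (Φ : 𝒜 ⥤ 𝒮)
    [HasDirectedColimits.{u} 𝒜] [HasBinaryProducts 𝒜] [PreservesDirectedColimits.{u} Φ]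
    (A : P ⥤ 𝒜) (S : 𝒮) (χ : S ⟶ Φ.obj ((tensor A).obj X.F))
    (D : 𝒳 ⥤ Over S)
    (hD : ∀ x : 𝒳, x.1 ∈ nonmaximal 𝒳 → WeaklyPresented l (D.obj x).left) :
    ∃ (σ : P →o 𝒳) (hσ : ∀ p, (σ p).1.norm = p)
      (τ : σ.monotone.functor ⋙ D ⋙ Over.forget S ⟶ A ⋙ Φ),
      ∀ p, τ.app p = (D.obj (σ p)).hom ≫ rho Φ A χ (σ p).1 ≫
        Φ.map (A.map (eqToHom (hσ p))) := by
  have hV : ∀ x : nonmaximal 𝒳, ∃ V : {V : Set X.carrier // #V < l},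
      ∀ (y : SharpIdeal X) (hxy : x.1.norm ≤ y.norm), (∀ v ∈ V.1, v ∈ x.1.1 ↔ v ∈ y.1) →
        (D.obj ⟨x.1, x.2.1⟩).hom ≫ rho Φ A χ x.1 ≫ Φ.map (A.map (homOfLE hxy)) =
          (D.obj ⟨x.1, x.2.1⟩).hom ≫ rho Φ A χ y := by
    intro x
    obtain ⟨V, h⟩ := (hD ⟨x.1, x.2.1⟩ x.2).exists_support hl A Φ
      ((D.obj ⟨x.1, x.2.1⟩).hom ≫ χ)
    refine ⟨V, fun y hxy hv => ?_⟩
    have h1 := h x.1 y hxy hv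
    rw [Φ.map_comp _ (A.map _), Category.assoc, Category.assoc] at h1
    rw [rho, rho, Category.assoc]
    exact h1
  choose V hV using hV
  -- The free choice is made for the supports just found, which exist exactly on the nonmaximal
  -- members, where weak presentability is assumed.
  obtain ⟨σ, hσ, hfree⟩ := hX.exists_free V
  have hnat : ∀ (p q : P) (h : p < q),
      (D.map (homOfLE (σ.monotone h.le))).left ≫ (D.obj (σ q)).hom ≫ rho Φ A χ (σ q).1 ≫
        Φ.map (A.map (eqToHom (hσ q))) =
      ((D.obj (σ p)).hom ≫ rho Φ A χ (σ p).1 ≫ Φ.map (A.map (eqToHom (hσ p)))) ≫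
        Φ.map (A.map (homOfLE h.le)) := by
    intro p q h
    obtain ⟨ha, hsub⟩ := hfree p q h
    have hn : (σ p).1.norm ≤ (σ q).1.norm := by rw [hσ, hσ]; exact h.le
    -- Equal traces on the support: one inclusion because `σ` is isotone, the other by freeness.
    have h1 := hV ⟨(σ p).1, ha⟩ (σ q).1 hn fun v hv =>
      ⟨fun hvp => σ.monotone h.le hvp, fun hvq => hsub ⟨hv, hvq⟩⟩
    have h2 : (D.obj (σ p)).hom ≫ rho Φ A χ (σ p).1 ≫ Φ.map (A.map (homOfLE hn)) =
        (D.obj (σ p)).hom ≫ rho Φ A χ (σ q).1 := h1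
    -- As `D` takes values over `S`, moving from `σ p` to `σ q` and then to `S` is the structure
    -- morphism at `σ p`, to which `h2` applies.
    rw [← Category.assoc, Over.w, ← Category.assoc, ← h2]
    simp only [Category.assoc, ← Φ.map_comp, ← A.map_comp]
    -- What remains are two composites in the poset `P` with the same ends, which coincide by proof
    -- irrelevance.
    rfl
  let τ : σ.monotone.functor ⋙ D ⋙ Over.forget S ⟶ A ⋙ Φ :=
    { app := fun p =>
        (D.obj (σ p)).hom ≫ rho Φ A χ (σ p).1 ≫ Φ.map (A.map (eqToHom (hσ p)))
      naturality := fun p q f => by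
        -- The lifter controls only strict inequalities; the case of an identity is pure
        -- functoriality.
        rcases (leOfHom f).eq_or_lt with rfl | h
        · obtain rfl : f = 𝟙 p := Subsingleton.elim _ _
          exact (congrArg (· ≫ _) (CategoryTheory.Functor.map_id _ p)).trans ((Category.id_comp _).trans
            ((Category.comp_id _).symm.trans (congrArg (_ ≫ ·) (CategoryTheory.Functor.map_id _ p).symm)))
        · exact hnat p q h }
  exact ⟨σ, hσ, τ, fun p => rfl⟩
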